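/- For $n\ge 1$, the Aztec diamond graph $AD_n$ is drawn with its edges in diagonal directions: its vertices are the points $(x,y)\in\{0,\dots,2n\}^2$ with $x+y$ odd, two of them being joined by an edge exactly when both coordinates differ by $1$. The centers of its $4n^2$ edges form a $2n\times 2n$ array ($x$ numbers the rows from the top, $y$ the columns from the left). For a matrix $A$, $AD_n(\mathrm{wt}_A)$ denotes $AD_n$ with the edge weights obtained by filling this array periodically with copies of $A$, the first one in the upper left corner (copies may fit only partially). For a weighted graph $G$, $\mathrm{M}(G)$ is the sum, over all perfect matchings of $G$, of the product of the weights of the edges of the matching. Let $a_i,b_i,c_i,d_i$ ($1\le i\le n$) be positive real numbers, let $\Delta_i=a_ic_i+b_id_i$, and let $C=[A_1\ A_2\ \cdots\ A_n]$ be the $4\times 2n$ matrix with blocks $$A_i=\begin{bmatrix} a_i&b_i\\ d_i&c_i\\ d_i/\Delta_i&c_i/\Delta_i\\ a_i/\Delta_i&b_i/\Delta_i\end{bmatrix}.$$ **Theorem.** (a) If $n=2k$ with $k\ge 1$, then $$\mathrm{M}(AD_{2k}(\mathrm{wt}_C))=\prod_{i=1}^k a_i^{k+1-i}\,b_{2k+1-i}^{k+1-i}\,c_{2k+1-i}^{k-i}\,d_i^{k-i}\cdot\prod_{i=1}^{2k}\Delta_i^{-k}\cdot\prod_{i=1}^{k-1}(\Delta_i+\Delta_{i+1})^i\cdot\prod_{i=1}^{k}(\Delta_{2k-i}+\Delta_{2k+1-i})^i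 .$$ (b) If $n=2k+1$ with $k\ge 0$, then $$\mathrm{M}(AD_{2k+1}(\mathrm{wt}_C))=\prod_{i=1}^{k+1} a_i^{k+1-i}\,b_{2k+2-i}^{k+1-i}\,c_{2k+2-i}^{k+1-i}\,d_i^{k+1-i}\cdot\Delta_{k+1}\cdot\prod_{i=1}^{2k+1}\Delta_i^{-k}\cdot\prod_{i=1}^{k}(\Delta_i+\Delta_{i+1})^i\cdot\prod_{i=1}^{k}(\Delta_{2k+1-i}+\Delta_{2k+2-i})^i .$$ -/

import Mathlib

/-- A set `S` of edges of a (multi)graph `G` is a perfect matching of `G` if every vertex of `G`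
is incident to precisely one edge in `S`. -/
def Graph.IsPerfectMatching {V E : Type*} (G : Graph V E) (S : Finset E) : Prop :=
  (∀ e ∈ S, e ∈ G.edgeSet) ∧ ∀ v ∈ G.vertexSet, ∃! e, e ∈ S ∧ G.Inc e v

open scoped Classical in
/-- The matching generating function `M(G)` of a graph with edge weights `w`: the sum, over all
perfect matchings of `G`, of the product of the weights of the edges in the matching. -/
noncomputable def Graph.matchingGenFun {V E : Type*} [Fintype E] (G : Graph V E) (w : E → ℝ) : ℝ :=
  ∑ S ∈ (Finset.univ : Finset (Finset E)).filter (fun S => G.IsPerfectMatching S), ∏ e ∈ S, w e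

namespace Aztec

/-- The two ends of the edge of the Aztec diamond graph whose center lies in row `r` and column
`s` (counted from `0`, rows from the top, columns from the left) of the array of edge centers.
This edge is a diagonal of the square with corners `(r, s)`, `(r, s+1)`, `(r+1, s)`,
`(r+1, s+1)`, namely the one joining the two corners with odd coordinate sum. -/
def edgeEnds (r s : ℕ) : Sym2 (ℕ × ℕ) :=
  if Even (r + s) then s((r, s + 1), (r + 1, s)) else s((r, s), (r + 1, s + 1))

/-- The Aztec diamond graph of order `n`, drawn with its edges in the diagonal directions so that
the edge centers form a `2n × 2n` array. A vertex `(x, y)` lies at height `x` below the top and at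
distance `y` from the left side of the drawing; the vertices are the points of `[0, 2n]²` with odd
coordinate sum. The edge `(r, s)` is the one whose center is the entry `(r, s)` of the array.
The `n²` cells are the `4`-cycles made of the edges in rows `2i`, `2i+1` and columns
`2j`, `2j+1` of the array, for `0 ≤ i, j < n`. -/
def diamondGraph (n : ℕ) : Graph (ℕ × ℕ) (Fin (2 * n) × Fin (2 * n)) where
  vertexSet := {v | v.1 ≤ 2 * n ∧ v.2 ≤ 2 * n ∧ Odd (v.1 + v.2)}
  edgeSet := Set.univ
  IsLink e x y := s(x, y) = edgeEnds e.1 e.2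
  isLink_symm := by
    intro e _
    exact ⟨fun x y h => by rw [Sym2.eq_swap]; exact h⟩
  eq_or_eq_of_isLink_of_isLink := by
    intro e x y v w h h'
    rw [← h', Sym2.eq_iff] at h
    rcases h with h | h
    · exact Or.inl h.1
    · exact Or.inr h.1
  edge_mem_iff_exists_isLink := by
    intro e
    refine ⟨fun _ => ?_, fun _ => Set.mem_univ e⟩
    unfold edgeEnds
    split_ifs
    · exact ⟨_, _, rfl⟩
    · exact ⟨_, _, rfl⟩
  left_mem_of_isLink := by
    rintro ⟨r, s⟩ ⟨x, x'⟩ ⟨y, y'⟩ h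
    have hr := r.isLt
    have hs := s.isLt
    simp only [edgeEnds] at h
    simp only [Set.mem_ofPred_eq]
    split_ifs at h with hp <;>
      simp only [Sym2.eq_iff, Prod.mk.injEq, Nat.even_iff] at h hp <;>
      rw [Nat.odd_iff] <;> omega

/-- The weight of the edges of the Aztec diamond graph of order `n` with weight pattern `A`: the
`2n × 2n` array of edge weights is filled periodically with copies of the `p × q` matrix `A`,
starting with a copy in the upper left corner. -/
def patternWeight {p q : ℕ} (hp : 0 < p) (hq : 0 < q) (A : Matrix (Fin p) (Fin q) ℝ) (n : ℕ) :
    Fin (2 * n) × Fin (2 * n) → ℝ :=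
  fun e => A ⟨e.1 % p, Nat.mod_lt _ hp⟩ ⟨e.2 % q, Nat.mod_lt _ hq⟩

/-- `M(AD_n(wt_A))`: the matching generating function of the Aztec diamond graph of order `n`
with weight pattern `A`. -/
noncomputable def M {p q : ℕ} (hp : 0 < p) (hq : 0 < q) (n : ℕ)
    (A : Matrix (Fin p) (Fin q) ℝ) : ℝ :=
  (diamondGraph n).matchingGenFun (patternWeight hp hq A n)

/-- `Δ_i = a_i c_i + b_i d_i`. -/
def Delta (a b c d : ℕ → ℝ) (i : ℕ) : ℝ := a i * c i + b i * d i

/-- The `4 × 2` block with index `i`. -/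
noncomputable def blockA (a b c d : ℕ → ℝ) (i : ℕ) : Matrix (Fin 4) (Fin 2) ℝ :=
  !![a i, b i;
     d i, c i;
     d i / Delta a b c d i, c i / Delta a b c d i;
     a i / Delta a b c d i, b i / Delta a b c d i]

/-- The `4 × 2n` weight pattern `C = [A_1 A_2 … A_n]` (the blocks are counted from `1`). -/
noncomputable def patternC (n : ℕ) (a b c d : ℕ → ℝ) : Matrix (Fin 4) (Fin (2 * n)) ℝ :=
  fun r s => blockA a b c d (s / 2 + 1) r ⟨s % 2, Nat.mod_lt _ Nat.two_pos⟩

end Aztec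

namespace Aztec

/-! The proof uses complementation (urban renewal) on the `n²` cells, the 4-cycles that partition
the edges. An inner vertex lies in two cells, a boundary vertex in one. A perfect matching assigns
each vertex to the cell that covers it, and once the assignment is fixed the cells contribute
independently. If `δ` is the sum of the two matching weights of a 4-cycle, its contribution for a
set `T` of covered vertices is `δ` times that for the complement of `T`, with each weight replaced
by the opposite one divided by `δ` (`cellFactor_compl`). Reversing all assignments therefore turns
matchings of order `m + 1` into edge sets that leave the boundary uncovered, which are matchings of
order `m` (`Z_reduction`).

The pattern is chosen so that two such reductions reproduce it with every index raised by one, up to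
factors attached to vertices (`shiftDual_shiftDual_wtC`). Each matching uses a vertex exactly once,
so these factors come out of the sum (`Z_gauge`). The cells of the original array have `δ = Δ_i` or
`1/Δ_i`. Those of the first reduction contain `Δ_i + Δ_{i+1}`, the source of the sums in the
formula. All other interior factors cancel down to one power of each inner `Δ_i` in the denominator.
The resulting recursion from order `n` to `n - 2` (`Z_wtC_add_two`) is solved by induction from
orders `0` and `1`. -/

/-! ### Perfect matchings as sets of edge centers, and vertex factors -/

/-- Exactly one edge of `S` covers the vertex `(2i, 2j+1)`. -/
def BlackOne (S : Finset (ℕ × ℕ)) (i j : ℕ) : Prop :=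
  ∃! e, e ∈ S ∧ (e.1 + 1) / 2 = i ∧ e.2 / 2 = j

/-- Exactly one edge of `S` covers the vertex `(2i+1, 2j)`. -/
def WhiteOne (S : Finset (ℕ × ℕ)) (i j : ℕ) : Prop :=
  ∃! e, e ∈ S ∧ e.1 / 2 = i ∧ (e.2 + 1) / 2 = j

/-- The edge centers of the Aztec diamond graph of order `n`. -/
def grid (n : ℕ) : Finset (ℕ × ℕ) := Finset.range (2 * n) ×ˢ Finset.range (2 * n)

/-- Perfect matchings of the Aztec diamond graph, as sets of edge centers. -/
def IsMatching (n : ℕ) (S : Finset (ℕ × ℕ)) : Prop :=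
  (∀ i < n + 1, ∀ j < n, BlackOne S i j) ∧ ∀ i < n, ∀ j < n + 1, WhiteOne S i j

open scoped Classical in
/-- The matching generating function of the Aztec diamond graph in terms of edge centers. -/
noncomputable def Z (n : ℕ) (w : ℕ × ℕ → ℝ) : ℝ :=
  ∑ S ∈ (grid n).powerset.filter (IsMatching n), ∏ e ∈ S, w e

theorem mem_grid {n : ℕ} {e : ℕ × ℕ} : e ∈ grid n ↔ e.1 < 2 * n ∧ e.2 < 2 * n := by
  simp [grid]

theorem Z_congr {n : ℕ} {w w' : ℕ × ℕ → ℝ} (h : ∀ e ∈ grid n, w e = w' e) : Z n w = Z n w' := by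
  refine Finset.sum_congr rfl fun S hS => Finset.prod_congr rfl fun e he => h e ?_
  simp only [Finset.mem_filter, Finset.mem_powerset] at hS
  exact hS.1 he

theorem Z_zero (w : ℕ × ℕ → ℝ) : Z 0 w = 1 := by
  classical
  have : (grid 0).powerset.filter (IsMatching 0) = {∅} := by
    ext S
    simp [grid, IsMatching]
  exact (Finset.sum_congr (s₂ := {∅}) (by convert this) fun _ _ => rfl).trans (by simp)

/-- Every edge has exactly one end of the form `(2i, 2j+1)`, so in a perfect matching the map to
that end is a bijection onto these vertices. -/
theorem prod_black {n : ℕ} {S : Finset (ℕ × ℕ)} (hS : S ⊆ grid n) (h : IsMatching n S)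
    (g : ℕ → ℕ → ℝ) : ∏ e ∈ S, g ((e.1 + 1) / 2) (e.2 / 2) =
      ∏ i ∈ Finset.range (n + 1), ∏ j ∈ Finset.range n, g i j := by
  rw [← Finset.prod_product' (Finset.range (n + 1)) (Finset.range n)]
  refine Finset.prod_nbij (fun e => ((e.1 + 1) / 2, e.2 / 2)) ?_ ?_ ?_ fun _ _ => rfl
  · intro e he
    have := mem_grid.1 (hS he)
    simp only [Finset.mem_product, Finset.mem_range]
    omega
  · intro e he e' he' hee
    have := mem_grid.1 (hS he)
    simp only [Prod.mk.injEq] at hee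
    exact (h.1 ((e.1 + 1) / 2) (by omega) (e.2 / 2) (by omega)).unique ⟨he, rfl, rfl⟩
      ⟨he', hee.1.symm, hee.2.symm⟩
  · rintro ⟨i, j⟩ hij
    simp only [Finset.coe_product, Set.mem_prod, Finset.coe_range, Set.mem_Iio] at hij
    obtain ⟨e, he, -⟩ := h.1 i hij.1 j hij.2
    exact ⟨e, he.1, by simp [he.2.1, he.2.2]⟩

theorem prod_white {n : ℕ} {S : Finset (ℕ × ℕ)} (hS : S ⊆ grid n) (h : IsMatching n S)
    (g : ℕ → ℕ → ℝ) : ∏ e ∈ S, g (e.1 / 2) ((e.2 + 1) / 2) =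
      ∏ i ∈ Finset.range n, ∏ j ∈ Finset.range (n + 1), g i j := by
  rw [← Finset.prod_product' (Finset.range n) (Finset.range (n + 1))]
  refine Finset.prod_nbij (fun e => (e.1 / 2, (e.2 + 1) / 2)) ?_ ?_ ?_ fun _ _ => rfl
  · intro e he
    have := mem_grid.1 (hS he)
    simp only [Finset.mem_product, Finset.mem_range]
    omega
  · intro e he e' he' hee
    have := mem_grid.1 (hS he)
    simp only [Prod.mk.injEq] at hee
    exact (h.2 (e.1 / 2) (by omega) ((e.2 + 1) / 2) (by omega)).unique ⟨he, rfl, rfl⟩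
      ⟨he', hee.1.symm, hee.2.symm⟩
  · rintro ⟨i, j⟩ hij
    simp only [Finset.coe_product, Set.mem_prod, Finset.coe_range, Set.mem_Iio] at hij
    obtain ⟨e, he, -⟩ := h.2 i hij.1 j hij.2
    exact ⟨e, he.1, by simp [he.2.1, he.2.2]⟩

/-- Multiplying the weights of all edges at a vertex by a constant. -/
theorem Z_gauge (n : ℕ) (g h : ℕ → ℕ → ℝ) (w : ℕ × ℕ → ℝ) :
    Z n (fun e => g ((e.1 + 1) / 2) (e.2 / 2) * h (e.1 / 2) ((e.2 + 1) / 2) * w e) =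
      (∏ i ∈ Finset.range (n + 1), ∏ j ∈ Finset.range n, g i j) *
        (∏ i ∈ Finset.range n, ∏ j ∈ Finset.range (n + 1), h i j) * Z n w := by
  simp only [Z, Finset.mul_sum]
  refine Finset.sum_congr rfl fun S hS => ?_
  simp only [Finset.mem_filter, Finset.mem_powerset] at hS
  rw [Finset.prod_mul_distrib, Finset.prod_mul_distrib, prod_black hS.1 hS.2,
    prod_white hS.1 hS.2]

/-! ### Agreement with the graph-theoretic definition -/

theorem inc_diamondGraph {n : ℕ} (e : Fin (2 * n) × Fin (2 * n)) (v : ℕ × ℕ) :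
    (diamondGraph n).Inc e v ↔
      v = (2 * (((e.1 : ℕ) + 1) / 2), 2 * ((e.2 : ℕ) / 2) + 1) ∨
        v = (2 * ((e.1 : ℕ) / 2) + 1, 2 * (((e.2 : ℕ) + 1) / 2)) := by
  obtain ⟨⟨r, hr⟩, ⟨s, hs⟩⟩ := e
  obtain ⟨x, y⟩ := v
  simp only [Graph.Inc, diamondGraph, edgeEnds, Prod.exists]
  constructor
  · rintro ⟨x', y', h⟩
    split_ifs at h with hp <;>
      simp only [Sym2.eq_iff, Prod.mk.injEq, Nat.even_iff] at h hp ⊢ <;> omega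
  · intro h
    -- The other end is the reflection of `(x, y)` in the center `(r + 1/2, s + 1/2)` of the edge.
    refine ⟨2 * r + 1 - x, 2 * s + 1 - y, ?_⟩
    split_ifs with hp <;>
      simp only [Sym2.eq_iff, Prod.mk.injEq, Nat.even_iff] at h hp ⊢ <;> omega

/-- Edge centers as points of `ℕ × ℕ`. -/
def centerEmb (n : ℕ) : Fin (2 * n) × Fin (2 * n) ↪ ℕ × ℕ :=
  Fin.valEmbedding.prodMap Fin.valEmbedding

theorem existsUnique_mem_map {α β : Type*} (f : α ↪ β) (S : Finset α) (p : β → Prop) :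
    (∃! e, e ∈ S.map f ∧ p e) ↔ ∃! e, e ∈ S ∧ p (f e) := by
  constructor
  · rintro ⟨e, ⟨he, hp⟩, hu⟩
    obtain ⟨e, he', rfl⟩ := Finset.mem_map.1 he
    exact ⟨e, ⟨he', hp⟩, fun e' h' =>
      f.injective (hu (f e') ⟨Finset.mem_map_of_mem f h'.1, h'.2⟩)⟩
  · rintro ⟨e, ⟨he, hp⟩, hu⟩
    refine ⟨f e, ⟨Finset.mem_map_of_mem f he, hp⟩, ?_⟩
    rintro e' ⟨h', hp'⟩
    obtain ⟨e', h'', rfl⟩ := Finset.mem_map.1 h'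
    rw [hu e' ⟨h'', hp'⟩]

theorem isPerfectMatching_iff {n : ℕ} (S : Finset (Fin (2 * n) × Fin (2 * n))) :
    (diamondGraph n).IsPerfectMatching S ↔ IsMatching n (S.map (centerEmb n)) := by
  have hb : ∀ i j : ℕ, (∃! e, e ∈ S ∧ (diamondGraph n).Inc e (2 * i, 2 * j + 1)) ↔
      BlackOne (S.map (centerEmb n)) i j := by
    intro i j
    rw [BlackOne, existsUnique_mem_map]
    refine existsUnique_congr fun e => and_congr_right fun _ => ?_
    rw [inc_diamondGraph]
    simp only [Prod.mk.injEq, centerEmb, Function.Embedding.coe_prodMap, Prod.map_fst,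
      Prod.map_snd, Fin.valEmbedding_apply]
    omega
  have hw : ∀ i j : ℕ, (∃! e, e ∈ S ∧ (diamondGraph n).Inc e (2 * i + 1, 2 * j)) ↔
      WhiteOne (S.map (centerEmb n)) i j := by
    intro i j
    rw [WhiteOne, existsUnique_mem_map]
    refine existsUnique_congr fun e => and_congr_right fun _ => ?_
    rw [inc_diamondGraph]
    simp only [Prod.mk.injEq, centerEmb, Function.Embedding.coe_prodMap, Prod.map_fst,
      Prod.map_snd, Fin.valEmbedding_apply]
    omega
  constructor
  · rintro ⟨-, h⟩
    refine ⟨fun i hi j hj => (hb i j).1 (h _ ?_), fun i hi j hj => (hw i j).1 (h _ ?_)⟩ <;>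
    · simp only [diamondGraph, Set.mem_ofPred_eq, Nat.odd_iff]
      omega
  · intro h
    refine ⟨fun _ _ => Set.mem_univ _, ?_⟩
    rintro ⟨x, y⟩ hv
    simp only [diamondGraph, Set.mem_ofPred_eq, Nat.odd_iff] at hv
    rcases Nat.mod_two_eq_zero_or_one x with hx | hx
    · obtain ⟨i, rfl⟩ : ∃ i, x = 2 * i := ⟨x / 2, by omega⟩
      obtain ⟨j, rfl⟩ : ∃ j, y = 2 * j + 1 := ⟨y / 2, by omega⟩
      exact (hb i j).2 (h.1 i (by omega) j (by omega))
    · obtain ⟨i, rfl⟩ : ∃ i, x = 2 * i + 1 := ⟨x / 2, by omega⟩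
      obtain ⟨j, rfl⟩ : ∃ j, y = 2 * j := ⟨y / 2, by omega⟩
      exact (hw i j).2 (h.2 i (by omega) j (by omega))

theorem map_centerEmb_univ (n : ℕ) : Finset.univ.map (centerEmb n) = grid n := by
  ext ⟨r, s⟩
  simp only [Finset.mem_map, Finset.mem_univ, true_and, mem_grid, Prod.exists, centerEmb,
    Function.Embedding.coe_prodMap, Prod.map_apply, Fin.valEmbedding_apply, Prod.mk.injEq]
  exact ⟨fun ⟨a, b, h⟩ => by omega, fun h => ⟨⟨r, h.1⟩, ⟨s, h.2⟩, rfl, rfl⟩⟩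

theorem matchingGenFun_eq_Z {n : ℕ} (w : ℕ × ℕ → ℝ) :
    (diamondGraph n).matchingGenFun (fun e => w (e.1, e.2)) = Z n w := by
  classical
  rw [Graph.matchingGenFun, Z]
  refine Finset.sum_bij (fun S _ => S.map (centerEmb n)) ?_ ?_ ?_ ?_
  · intro S hS
    simp only [Finset.mem_filter, Finset.mem_univ, true_and, Finset.mem_powerset] at hS ⊢
    exact ⟨map_centerEmb_univ n ▸ Finset.map_subset_map.2 (Finset.subset_univ S),
      (isPerfectMatching_iff S).1 hS⟩
  · intro S _ S' _ h
    exact Finset.map_injective _ h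
  · intro S hS
    simp only [Finset.mem_filter, Finset.mem_powerset] at hS
    obtain ⟨T, -, rfl⟩ := Finset.subset_map_iff.1 (hS.1.trans_eq (map_centerEmb_univ n).symm)
    exact ⟨T, by simpa [isPerfectMatching_iff] using hS.2, rfl⟩
  · intro S _
    rw [Finset.prod_map]
    rfl

/-! ### Edge sets described cell by cell, and complementation in one cell -/

/-- Which of the four edges of a cell (top row first) belong to a set of edges. -/
abbrev CellState := Bool × Bool × Bool × Bool

/-- The state of the cell `c` in the edge set `S`. -/
def toState (S : Finset (ℕ × ℕ)) (c : ℕ × ℕ) : CellState :=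
  (decide ((2 * c.1, 2 * c.2) ∈ S), decide ((2 * c.1, 2 * c.2 + 1) ∈ S),
    decide ((2 * c.1 + 1, 2 * c.2) ∈ S), decide ((2 * c.1 + 1, 2 * c.2 + 1) ∈ S))

/-- The entry of a cell state in row `p` and column `q`. -/
def pick (l : CellState) (p q : ℕ) : Bool :=
  if p = 0 then if q = 0 then l.1 else l.2.1 else if q = 0 then l.2.2.1 else l.2.2.2

/-- The product of the weights of the edges of the cell `c` in the state `l`. -/
def stateWeight (w : ℕ × ℕ → ℝ) (c : ℕ × ℕ) (l : CellState) : ℝ :=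
  (if l.1 then w (2 * c.1, 2 * c.2) else 1) * (if l.2.1 then w (2 * c.1, 2 * c.2 + 1) else 1) *
    ((if l.2.2.1 then w (2 * c.1 + 1, 2 * c.2) else 1) *
      (if l.2.2.2 then w (2 * c.1 + 1, 2 * c.2 + 1) else 1))

/-- Exactly one (`t = true`) or none (`t = false`) of `x`, `y` is true. -/
def Half (x y t : Bool) : Prop := (x && y) = false ∧ (x || y) = t

instance (x y t : Bool) : Decidable (Half x y t) := by unfold Half; infer_instance

/-- The state `l` covers exactly those among the top, left, right and bottom vertices of a cell
that are marked in `T`. -/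
def Fits (l T : CellState) : Prop :=
  Half l.1 l.2.1 T.1 ∧ Half l.1 l.2.2.1 T.2.1 ∧ Half l.2.1 l.2.2.2 T.2.2.1 ∧
    Half l.2.2.1 l.2.2.2 T.2.2.2

instance (l T : CellState) : Decidable (Fits l T) := by unfold Fits; infer_instance

/-- The matching generating function of the cell `c` with the set `T` of covered vertices. -/
def cellFactor (w : ℕ × ℕ → ℝ) (c : ℕ × ℕ) (T : CellState) : ℝ :=
  ∑ l : CellState, if Fits l T then stateWeight w c l else 0

/-- The sum of the weights of the two perfect matchings of the cell `c`. -/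
def cellDelta (w : ℕ × ℕ → ℝ) (c : ℕ × ℕ) : ℝ :=
  w (2 * c.1, 2 * c.2) * w (2 * c.1 + 1, 2 * c.2 + 1) +
    w (2 * c.1, 2 * c.2 + 1) * w (2 * c.1 + 1, 2 * c.2)

/-- The opposite edge in the same cell. -/
def opp (e : ℕ × ℕ) : ℕ × ℕ := (4 * (e.1 / 2) + 1 - e.1, 4 * (e.2 / 2) + 1 - e.2)

/-- Each weight is replaced by the opposite weight in its cell, divided by `cellDelta`. -/
noncomputable def dual (w : ℕ × ℕ → ℝ) (e : ℕ × ℕ) : ℝ :=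
  w (opp e) / cellDelta w (e.1 / 2, e.2 / 2)

/-- Complementation of the covered set of a cell. -/
def compl (T : CellState) : CellState := (!T.1, !T.2.1, !T.2.2.1, !T.2.2.2)

theorem dual_cell (w : ℕ × ℕ → ℝ) (i j : ℕ) :
    dual w (2 * i, 2 * j) = w (2 * i + 1, 2 * j + 1) / cellDelta w (i, j) ∧
    dual w (2 * i, 2 * j + 1) = w (2 * i + 1, 2 * j) / cellDelta w (i, j) ∧
    dual w (2 * i + 1, 2 * j) = w (2 * i, 2 * j + 1) / cellDelta w (i, j) ∧
    dual w (2 * i + 1, 2 * j + 1) = w (2 * i, 2 * j) / cellDelta w (i, j) := by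
  have h0 : ∀ i, 2 * i / 2 = i := fun i => by omega
  have h1 : ∀ i, (2 * i + 1) / 2 = i := fun i => by omega
  have h2 : ∀ i, 4 * i + 1 - 2 * i = 2 * i + 1 := fun i => by omega
  have h3 : ∀ i, 4 * i + 1 - (2 * i + 1) = 2 * i := fun i => by omega
  simp only [dual, opp, h0, h1, h2, h3, and_self]

/-- With `δ` the cell's delta: covering all four vertices gives `δ` against the empty set's `1`;
covering none gives `1` against the dual delta `1/δ`; covering the two ends of one edge gives its
weight, against the opposite edge, whose dual weight is that weight over `δ`. For every other `T`
both sides vanish. -/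
theorem cellFactor_compl (w : ℕ × ℕ → ℝ) (c : ℕ × ℕ) (hc : cellDelta w c ≠ 0) (T : CellState) :
    cellFactor w c T = cellDelta w c * cellFactor (dual w) c (compl T) := by
  obtain ⟨i, j⟩ := c
  obtain ⟨d1, d2, d3, d4⟩ := dual_cell w i j
  obtain ⟨t1, t2, t3, t4⟩ := T
  simp only [cellFactor, Fintype.sum_prod_type, Fintype.sum_bool, stateWeight, d1, d2, d3, d4]
  cases t1 <;> cases t2 <;> cases t3 <;> cases t4 <;>
    (simp [Fits, Half, compl] <;> field_simp <;> simp only [cellDelta] <;> ring)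

/-- The edge set with given cell states. -/
def ofState (n : ℕ) (f : Fin n × Fin n → CellState) : Finset (ℕ × ℕ) :=
  (grid n).filter fun e => ∃ (h₁ : e.1 / 2 < n) (h₂ : e.2 / 2 < n),
    pick (f (⟨e.1 / 2, h₁⟩, ⟨e.2 / 2, h₂⟩)) (e.1 % 2) (e.2 % 2) = true

theorem ofState_toState {n : ℕ} {S : Finset (ℕ × ℕ)} (hS : S ⊆ grid n) :
    ofState n (fun c => toState S (c.1, c.2)) = S := by
  ext ⟨r, s⟩
  rw [ofState, Finset.mem_filter]
  have h0 : ∀ i, 2 * i / 2 = i := fun i => by omega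
  have h1 : ∀ i, (2 * i + 1) / 2 = i := fun i => by omega
  have h2 : ∀ i, (2 * i + 1) % 2 = 1 := fun i => by omega
  have key : pick (toState S (r / 2, s / 2)) (r % 2) (s % 2) = decide ((r, s) ∈ S) := by
    obtain ⟨i, rfl | rfl⟩ : ∃ i, r = 2 * i ∨ r = 2 * i + 1 := ⟨r / 2, by omega⟩ <;>
    obtain ⟨j, rfl | rfl⟩ : ∃ j, s = 2 * j ∨ s = 2 * j + 1 := ⟨s / 2, by omega⟩ <;>
    simp [pick, toState, h0, h1, h2]
  constructor
  · rintro ⟨_, _, _, h⟩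
    exact of_decide_eq_true (key.symm.trans h)
  · intro h
    have := mem_grid.1 (hS h)
    simp only at this
    exact ⟨hS h, by omega, by omega, key.trans (decide_eq_true h)⟩

theorem toState_ofState {n : ℕ} (f : Fin n × Fin n → CellState) (c : Fin n × Fin n) :
    toState (ofState n f) (c.1, c.2) = f c := by
  obtain ⟨⟨i, hi⟩, ⟨j, hj⟩⟩ := c
  have h0 : ∀ i, 2 * i / 2 = i := fun i => by omega
  have h1 : ∀ i, (2 * i + 1) / 2 = i := fun i => by omega
  have h2 : ∀ i, (2 * i + 1) % 2 = 1 := fun i => by omega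
  have h3 : ∀ i, 2 * i < 2 * n ↔ i < n := fun i => by omega
  have h4 : ∀ i, 2 * i + 1 < 2 * n ↔ i < n := fun i => by omega
  simp [toState, ofState, mem_grid, h0, h1, h2, h3, h4, hi, hj, pick]

theorem prod_range_two_mul (n : ℕ) (g : ℕ → ℝ) :
    ∏ r ∈ Finset.range (2 * n), g r = ∏ i ∈ Finset.range n, g (2 * i) * g (2 * i + 1) := by
  induction n with
  | zero => simp
  | succ n ih =>
    rw [show 2 * (n + 1) = 2 * n + 1 + 1 by ring, Finset.prod_range_succ, Finset.prod_range_succ,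
      Finset.prod_range_succ _ n, ih, mul_assoc]

theorem prod_eq_stateWeight {n : ℕ} {S : Finset (ℕ × ℕ)} (hS : S ⊆ grid n) (w : ℕ × ℕ → ℝ) :
    ∏ e ∈ S, w e =
      ∏ c : Fin n × Fin n, stateWeight w (c.1, c.2) (toState S (c.1, c.2)) := by
  have h1 : ∏ e ∈ S, w e = ∏ e ∈ grid n, if e ∈ S then w e else 1 := by
    rw [Finset.prod_ite_mem, Finset.inter_eq_right.2 hS]
  rw [h1, grid, Finset.prod_product, prod_range_two_mul, Fintype.prod_prod_type,
    ← Fin.prod_univ_eq_prod_range (fun i => (∏ y ∈ Finset.range (2 * n),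
      if (2 * i, y) ∈ S then w (2 * i, y) else 1) * ∏ y ∈ Finset.range (2 * n),
      if (2 * i + 1, y) ∈ S then w (2 * i + 1, y) else 1)]
  refine Finset.prod_congr rfl fun i _ => ?_
  rw [prod_range_two_mul, prod_range_two_mul, ← Finset.prod_mul_distrib,
    ← Fin.prod_univ_eq_prod_range (fun j => _ * _)]
  simp [stateWeight, toState]

theorem sum_powerset_eq_sum_states {n : ℕ} (F : Finset (ℕ × ℕ) → ℝ) :
    ∑ S ∈ (grid n).powerset, F S = ∑ f : Fin n × Fin n → CellState, F (ofState n f) := by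
  refine Finset.sum_nbij' (fun S c => toState S (c.1, c.2)) (ofState n) ?_ ?_ ?_ ?_ ?_
  · exact fun _ _ => Finset.mem_univ _
  · exact fun f _ => Finset.mem_powerset.2 (Finset.filter_subset _ _)
  · exact fun S hS => ofState_toState (Finset.mem_powerset.1 hS)
  · exact fun f _ => funext (toState_ofState f)
  · exact fun S hS => by rw [ofState_toState (Finset.mem_powerset.1 hS)]

/-- The cells partition the edges, so both the weight and the covering condition split over cells;
expanding the product of sums gives the sum over families of cell states. -/
theorem sum_fits_eq_prod {n : ℕ} (w : ℕ × ℕ → ℝ) (T : Fin n × Fin n → CellState) :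
    (∑ S ∈ (grid n).powerset,
      if ∀ c : Fin n × Fin n, Fits (toState S (c.1, c.2)) (T c) then ∏ e ∈ S, w e else 0) =
      ∏ c : Fin n × Fin n, cellFactor w (c.1, c.2) (T c) := by
  classical
  rw [sum_powerset_eq_sum_states]
  simp only [cellFactor]
  rw [Finset.prod_univ_sum, Fintype.piFinset_univ]
  refine Finset.sum_congr rfl fun f _ => ?_
  rw [Finset.prod_ite_zero]
  rw [prod_eq_stateWeight (S := ofState n f) (Finset.filter_subset _ _)]
  simp only [toState_ofState, Finset.mem_univ, true_implies]

/-! ### Distribution of the vertices among the cells -/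

/-- A choice, for each vertex of the Aztec diamond graph, of a side: `true` stands for the cell
below (or to the right of) the vertex, `false` for the cell above (or to the left of) it. -/
abbrev Cover (n : ℕ) := (Fin (n + 1) → Fin n → Bool) × (Fin n → Fin (n + 1) → Bool)

/-- The vertices of the cell `c` that are assigned to it by `x`. -/
def corners {n : ℕ} (x : Cover n) (c : Fin n × Fin n) : CellState :=
  (x.1 c.1.castSucc c.2, x.2 c.1 c.2.castSucc, !x.2 c.1 c.2.succ, !x.1 c.1.succ c.2)

/-- The boundary vertices are all assigned to cells (`β = true`) or none of them is. -/
def Bdry {n : ℕ} (β : Bool) (x : Cover n) : Prop :=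
  ∀ j : Fin n, (x.1 0 j = β ∧ x.1 (Fin.last n) j = !β) ∧ x.2 j 0 = β ∧ x.2 j (Fin.last n) = !β

instance {n : ℕ} (β : Bool) (x : Cover n) : Decidable (Bdry β x) := by
  unfold Bdry; infer_instance

/-- The pair of edges `(r, 2j)`, `(r, 2j+1)` contains exactly one edge of `S`, or none. -/
def HalfRow (S : Finset (ℕ × ℕ)) (r j : ℕ) (t : Bool) : Prop :=
  Half (decide ((r, 2 * j) ∈ S)) (decide ((r, 2 * j + 1) ∈ S)) t

/-- The pair of edges `(2i, s)`, `(2i+1, s)` contains exactly one edge of `S`, or none. -/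
def HalfCol (S : Finset (ℕ × ℕ)) (i s : ℕ) (t : Bool) : Prop :=
  Half (decide ((2 * i, s) ∈ S)) (decide ((2 * i + 1, s) ∈ S)) t

/-- Every inner vertex is covered once, every boundary vertex once or not at all. -/
def Valid (m : ℕ) (β : Bool) (S : Finset (ℕ × ℕ)) : Prop :=
  (∀ j < m + 1, (HalfRow S 0 j β ∧ HalfRow S (2 * m + 1) j β) ∧
    HalfCol S j 0 β ∧ HalfCol S j (2 * m + 1) β) ∧
  ∀ i < m, ∀ j < m + 1, (∃ t, HalfRow S (2 * i + 1) j (!t) ∧ HalfRow S (2 * i + 2) j t) ∧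
    ∃ t, HalfCol S j (2 * i + 1) (!t) ∧ HalfCol S j (2 * i + 2) t

theorem Half.eq_or {x y t : Bool} (h : Half x y t) : t = (x || y) := h.2.symm

theorem exists_cover_of_valid {m : ℕ} {β : Bool} {S : Finset (ℕ × ℕ)} (h : Valid m β S) :
    ∃ x : Cover (m + 1), Bdry β x ∧ ∀ c : Fin (m + 1) × Fin (m + 1),
      Fits (toState S (c.1, c.2)) (corners x c) := by
  obtain ⟨hb, hi⟩ := h
  -- A vertex goes to the cell below it (or to its right) exactly when that cell has an edge of `S`
  -- covering it. The last row and column have no such cell, so there the boundary condition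
  -- dictates the value.
  refine ⟨(fun i j => if i = Fin.last _ then !β else
      decide ((2 * i.1, 2 * j.1) ∈ S) || decide ((2 * i.1, 2 * j.1 + 1) ∈ S),
    fun i j => if j = Fin.last _ then !β else
      decide ((2 * i.1, 2 * j.1) ∈ S) || decide ((2 * i.1 + 1, 2 * j.1) ∈ S)), ?_, ?_⟩
  · intro j
    have := hb j j.2
    have h0 : (0 : Fin (m + 2)) ≠ Fin.last (m + 1) := by simp [Fin.ext_iff]
    simp only [h0, if_false, if_true, and_true, Fin.val_zero, mul_zero]
    exact ⟨this.1.1.eq_or.symm, this.2.1.eq_or.symm⟩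
  · rintro ⟨i, j⟩
    have hne : ∀ i : Fin (m + 1), i.castSucc ≠ Fin.last (m + 1) := fun i =>
      (Fin.castSucc_lt_last i).ne
    simp only [Fits, corners, toState, hne, if_false, Fin.val_castSucc, Fin.val_succ]
    refine ⟨⟨?_, rfl⟩, ⟨?_, rfl⟩, ?_, ?_⟩
    · rcases i with ⟨_ | i, hil⟩
      · exact (hb j j.2).1.1.1
      · obtain ⟨⟨t, -, h⟩, -⟩ := hi i (by omega) j j.2
        exact h.1
    · rcases j with ⟨_ | j, hjl⟩
      · exact (hb i i.2).2.1.1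
      · obtain ⟨-, t, -, h⟩ := hi j (by omega) i i.2
        exact h.1
    · by_cases hj : j = Fin.last m
      · subst hj
        simpa [HalfCol] using (hb i i.2).2.2
      · have hj' : j.1 < m := Fin.val_lt_last hj
        obtain ⟨-, t, h, h'⟩ := hi j hj' i i.2
        rw [if_neg (by simpa [Fin.ext_iff] using hj'.ne)]
        have := h'.eq_or
        rw [this] at h
        exact h
    · by_cases hj : i = Fin.last m
      · subst hj
        simpa [HalfRow] using (hb j j.2).1.2
      · have hj' : i.1 < m := Fin.val_lt_last hj
        obtain ⟨⟨t, h, h'⟩, -⟩ := hi i hj' j j.2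
        rw [if_neg (by simpa [Fin.ext_iff] using hj'.ne)]
        have := h'.eq_or
        rw [this] at h
        exact h

theorem valid_of_cover {m : ℕ} {β : Bool} {S : Finset (ℕ × ℕ)} {x : Cover (m + 1)}
    (hx : Bdry β x) (h : ∀ c : Fin (m + 1) × Fin (m + 1),
      Fits (toState S (c.1, c.2)) (corners x c)) : Valid m β S := by
  refine ⟨fun j hj => ⟨⟨?_, ?_⟩, ?_, ?_⟩, fun i hi j hj => ⟨?_, ?_⟩⟩
  · have := (h (0, ⟨j, hj⟩)).1
    rwa [show (corners x (0, ⟨j, hj⟩)).1 = β from (hx ⟨j, hj⟩).1.1] at this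
  · have := (h (Fin.last m, ⟨j, hj⟩)).2.2.2
    rwa [show (corners x (Fin.last m, ⟨j, hj⟩)).2.2.2 = β by
      simp [corners, (hx ⟨j, hj⟩).1.2]] at this
  · have := (h (⟨j, hj⟩, 0)).2.1
    rwa [show (corners x (⟨j, hj⟩, 0)).2.1 = β from (hx ⟨j, hj⟩).2.1] at this
  · have := (h (⟨j, hj⟩, Fin.last m)).2.2.1
    rwa [show (corners x (⟨j, hj⟩, Fin.last m)).2.2.1 = β by
      simp [corners, (hx ⟨j, hj⟩).2.2]] at this
  · exact ⟨x.1 ⟨i + 1, by omega⟩ ⟨j, hj⟩, (h (⟨i, by omega⟩, ⟨j, hj⟩)).2.2.2,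
      (h (⟨i + 1, by omega⟩, ⟨j, hj⟩)).1⟩
  · exact ⟨x.2 ⟨j, hj⟩ ⟨i + 1, by omega⟩, (h (⟨j, hj⟩, ⟨i, by omega⟩)).2.2.1,
      (h (⟨j, hj⟩, ⟨i + 1, by omega⟩)).2.1⟩

theorem cover_unique {n : ℕ} {β : Bool} {S : Finset (ℕ × ℕ)} {x y : Cover n}
    (hx : Bdry β x) (hy : Bdry β y)
    (hx' : ∀ c : Fin n × Fin n, Fits (toState S (c.1, c.2)) (corners x c))
    (hy' : ∀ c : Fin n × Fin n, Fits (toState S (c.1, c.2)) (corners y c)) : x = y := by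
  refine Prod.ext ?_ ?_
  · funext i j
    induction i using Fin.lastCases with
    | last => rw [(hx j).1.2, (hy j).1.2]
    | cast i => exact (hx' (i, j)).1.eq_or.trans (hy' (i, j)).1.eq_or.symm
  · funext i j
    induction j using Fin.lastCases with
    | last => rw [(hx i).2.2, (hy i).2.2]
    | cast j => exact (hx' (i, j)).2.1.eq_or.trans (hy' (i, j)).2.1.eq_or.symm

-- A valid edge set determines its assignment of vertices to cells, so summing over assignments
-- first counts every valid set once.
open scoped Classical in
theorem sum_valid (m : ℕ) (β : Bool) (w : ℕ × ℕ → ℝ) :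
    ∑ S ∈ (grid (m + 1)).powerset.filter (Valid m β), ∏ e ∈ S, w e =
      ∑ x : Cover (m + 1), if Bdry β x then
        ∏ c : Fin (m + 1) × Fin (m + 1), cellFactor w (c.1, c.2) (corners x c) else 0 := by
  have h1 : ∀ x : Cover (m + 1), (if Bdry β x then
      ∏ c : Fin (m + 1) × Fin (m + 1), cellFactor w (c.1, c.2) (corners x c) else 0) =
      ∑ S ∈ (grid (m + 1)).powerset, if Bdry β x ∧ ∀ c : Fin (m + 1) × Fin (m + 1),
        Fits (toState S (c.1, c.2)) (corners x c) then ∏ e ∈ S, w e else 0 := by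
    intro x
    rw [← sum_fits_eq_prod]
    split_ifs with h
    · exact Finset.sum_congr rfl fun S _ => by simp only [h, true_and]
    · simp [h]
  rw [Finset.sum_congr rfl fun x _ => h1 x, Finset.sum_comm, Finset.sum_filter]
  refine Finset.sum_congr rfl fun S _ => ?_
  split_ifs with h
  · obtain ⟨x, hx, hx'⟩ := exists_cover_of_valid h
    rw [Finset.sum_eq_single x]
    · rw [if_pos ⟨hx, hx'⟩]
    · exact fun y _ hy => if_neg fun h' => hy (cover_unique h'.1 hx h'.2 hx')
    · simp
  · exact (Finset.sum_eq_zero fun x _ => if_neg fun h' => h (valid_of_cover h'.1 h'.2)).symm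

open scoped Classical in
/-- The complementation theorem for the cells of the Aztec diamond graph. -/
theorem sum_valid_compl (m : ℕ) (w : ℕ × ℕ → ℝ)
    (hw : ∀ i < m + 1, ∀ j < m + 1, cellDelta w (i, j) ≠ 0) :
    ∑ S ∈ (grid (m + 1)).powerset.filter (Valid m true), ∏ e ∈ S, w e =
      (∏ i ∈ Finset.range (m + 1), ∏ j ∈ Finset.range (m + 1), cellDelta w (i, j)) *
        ∑ S ∈ (grid (m + 1)).powerset.filter (Valid m false), ∏ e ∈ S, dual w e := by
  have hprod : ∏ i ∈ Finset.range (m + 1), ∏ j ∈ Finset.range (m + 1), cellDelta w (i, j) =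
      ∏ c : Fin (m + 1) × Fin (m + 1), cellDelta w (c.1, c.2) := by
    rw [Fintype.prod_prod_type, ← Fin.prod_univ_eq_prod_range
      (fun i => ∏ j ∈ Finset.range (m + 1), cellDelta w (i, j))]
    exact Finset.prod_congr rfl fun i _ =>
      (Fin.prod_univ_eq_prod_range (fun j => cellDelta w (i, j)) _).symm
  rw [sum_valid, sum_valid, hprod, Finset.mul_sum]
  -- Reversing every choice complements the covered set of each cell and exchanges the two boundary
  -- conditions.
  let σ : Cover (m + 1) ≃ Cover (m + 1) := Function.Involutive.toPerm
    (fun x => (fun i j => !x.1 i j, fun i j => !x.2 i j)) fun x => by simp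
  refine Fintype.sum_equiv σ _ _ fun x => ?_
  have hb : Bdry false (σ x) ↔ Bdry true x := by
    simp [Bdry, σ, Function.Involutive.toPerm]
  have hc : ∀ c, corners (σ x) c = compl (corners x c) := fun c => rfl
  simp only [hb, hc]
  split_ifs
  · rw [← Finset.prod_mul_distrib]
    exact Finset.prod_congr rfl fun c _ =>
      cellFactor_compl w _ (hw _ c.1.2 _ c.2.2) _
  · simp

/-! ### Vertex conditions as conditions on the adjacent cells -/

theorem existsUnique_two {S : Finset (ℕ × ℕ)} {p q : ℕ × ℕ} (hpq : p ≠ q) :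
    (∃! e, e ∈ S ∧ (e = p ∨ e = q)) ↔ Half (decide (p ∈ S)) (decide (q ∈ S)) true := by
  simp only [Half, ExistsUnique]
  grind

/-- The four edges at an inner vertex form two pairs, one in each adjacent cell; `t` records which
pair supplies the single edge. -/
theorem existsUnique_four {S : Finset (ℕ × ℕ)} {p q r s : ℕ × ℕ} (h : [p, q, r, s].Nodup) :
    (∃! e, e ∈ S ∧ (e = p ∨ e = q ∨ e = r ∨ e = s)) ↔
      ∃ t, Half (decide (p ∈ S)) (decide (q ∈ S)) (!t) ∧
        Half (decide (r ∈ S)) (decide (s ∈ S)) t := by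
  simp only [List.nodup_cons, List.mem_cons, not_or] at h
  simp only [Half, ExistsUnique, Bool.exists_bool]
  by_cases hp : p ∈ S <;> by_cases hq : q ∈ S <;> by_cases hr : r ∈ S <;>
    by_cases hs : s ∈ S <;> simp only [hp, hq, hr, hs] <;> simp <;> grind

theorem blackOne_succ (S : Finset (ℕ × ℕ)) (i j : ℕ) : BlackOne S (i + 1) j ↔
    ∃ t, HalfRow S (2 * i + 1) j (!t) ∧ HalfRow S (2 * i + 2) j t := by
  refine Iff.trans (existsUnique_congr fun e => and_congr_right fun _ => ?_)
    (existsUnique_four (by simp))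
  simp only [Prod.ext_iff]
  omega

theorem whiteOne_succ (S : Finset (ℕ × ℕ)) (i j : ℕ) : WhiteOne S i (j + 1) ↔
    ∃ t, HalfCol S i (2 * j + 1) (!t) ∧ HalfCol S i (2 * j + 2) t := by
  refine Iff.trans (existsUnique_congr fun e => and_congr_right fun _ => ?_)
    (existsUnique_four (by simp))
  simp only [Prod.ext_iff]
  omega

theorem blackOne_zero (S : Finset (ℕ × ℕ)) (j : ℕ) : BlackOne S 0 j ↔ HalfRow S 0 j true := by
  refine Iff.trans (existsUnique_congr fun e => and_congr_right fun _ => ?_)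
    (existsUnique_two (by simp))
  simp only [Prod.ext_iff]
  omega

theorem whiteOne_zero (S : Finset (ℕ × ℕ)) (i : ℕ) : WhiteOne S i 0 ↔ HalfCol S i 0 true := by
  refine Iff.trans (existsUnique_congr fun e => and_congr_right fun _ => ?_)
    (existsUnique_two (by simp))
  simp only [Prod.ext_iff]
  omega

theorem blackOne_last {m : ℕ} {S : Finset (ℕ × ℕ)} (hS : S ⊆ grid (m + 1)) (j : ℕ) :
    BlackOne S (m + 1) j ↔ HalfRow S (2 * m + 1) j true := by
  refine Iff.trans (existsUnique_congr fun e => and_congr_right fun he => ?_)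
    (existsUnique_two (by simp))
  -- Row `2m + 2` would satisfy the same equation; the bound of the grid rules it out.
  have := mem_grid.1 (hS he)
  simp only [Prod.ext_iff]
  omega

theorem whiteOne_last {m : ℕ} {S : Finset (ℕ × ℕ)} (hS : S ⊆ grid (m + 1)) (i : ℕ) :
    WhiteOne S i (m + 1) ↔ HalfCol S i (2 * m + 1) true := by
  refine Iff.trans (existsUnique_congr fun e => and_congr_right fun he => ?_)
    (existsUnique_two (by simp))
  have := mem_grid.1 (hS he)
  simp only [Prod.ext_iff]
  omega

theorem isMatching_iff_valid {m : ℕ} {S : Finset (ℕ × ℕ)} (hS : S ⊆ grid (m + 1)) :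
    IsMatching (m + 1) S ↔ Valid m true S := by
  simp only [IsMatching, Valid, ← blackOne_succ, ← whiteOne_succ, ← blackOne_zero,
    ← whiteOne_zero, ← blackOne_last hS, ← whiteOne_last hS]
  constructor
  · rintro ⟨hb, hw⟩
    exact ⟨fun j hj => ⟨⟨hb _ (by omega) _ hj, hb _ (by omega) _ hj⟩, hw _ hj _ (by omega),
      hw _ hj _ (by omega)⟩, fun i hi j hj => ⟨hb _ (by omega) _ hj, hw _ hj _ (by omega)⟩⟩
  · rintro ⟨hb, hi⟩
    refine ⟨fun i h j hj => ?_, fun j hj i h => ?_⟩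
    all_goals
      rcases i with _ | i
      · first | exact (hb j hj).1.1 | exact (hb j hj).2.1
      · rcases Nat.lt_or_ge i m with him | him
        · first | exact (hi i him j hj).1 | exact (hi i him j hj).2
        · obtain rfl : i = m := by omega
          first | exact (hb j hj).1.2 | exact (hb j hj).2.2

/-! ### Uncovered boundary: the diamond of the next smaller order -/

/-- The shift by `(1, 1)`. -/
def diagShift : ℕ × ℕ ↪ ℕ × ℕ where
  toFun e := (e.1 + 1, e.2 + 1)
  inj' := fun e e' h => by simpa [Prod.ext_iff] using h

theorem diagShift_apply (e : ℕ × ℕ) : diagShift e = (e.1 + 1, e.2 + 1) := rfl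

theorem half_false {x y : Bool} : Half x y false ↔ x = false ∧ y = false := by
  cases x <;> cases y <;> simp [Half]

/-- The diagonal shift exchanges the two color classes: `(2i+1, 2j)` moves to `(2i+2, 2j+1)`. -/
theorem blackOne_map (S : Finset (ℕ × ℕ)) (i j : ℕ) :
    BlackOne (S.map diagShift) (i + 1) j ↔ WhiteOne S i j := by
  rw [BlackOne, existsUnique_mem_map]
  refine existsUnique_congr fun e => and_congr_right fun _ => ?_
  simp only [diagShift_apply]
  omega

theorem whiteOne_map (S : Finset (ℕ × ℕ)) (i j : ℕ) :
    WhiteOne (S.map diagShift) i (j + 1) ↔ BlackOne S i j := by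
  rw [WhiteOne, existsUnique_mem_map]
  refine existsUnique_congr fun e => and_congr_right fun _ => ?_
  simp only [diagShift_apply]
  omega

theorem isMatching_iff_valid_map {m : ℕ} {S : Finset (ℕ × ℕ)} (hS : S ⊆ grid m) :
    IsMatching m S ↔ Valid m false (S.map diagShift) := by
  have hout : ∀ r s, (r = 0 ∨ r = 2 * m + 1 ∨ s = 0 ∨ s = 2 * m + 1) →
      (r, s) ∉ S.map diagShift := by
    intro r s h hmem
    obtain ⟨e, he, h'⟩ := Finset.mem_map.1 hmem
    have := mem_grid.1 (hS he)
    simp only [diagShift_apply, Prod.mk.injEq] at h'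
    omega
  simp only [IsMatching, Valid, ← blackOne_succ, ← whiteOne_succ, blackOne_map, whiteOne_map]
  simp only [HalfRow, HalfCol, half_false, decide_eq_false_iff_not]
  constructor
  · rintro ⟨hb, hw⟩
    refine ⟨fun j hj => ⟨⟨⟨?_, ?_⟩, ?_, ?_⟩, ⟨?_, ?_⟩, ?_, ?_⟩,
      fun i hi j hj => ⟨hw i hi j hj, hb j hj i hi⟩⟩ <;>
    exact hout _ _ (by omega)
  · rintro ⟨-, h⟩
    exact ⟨fun i hi j hj => (h j hj i hi).2, fun i hi j hj => (h i hi j hj).1⟩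

/-- Leaving all boundary vertices uncovered empties rows and columns `0` and `2m + 1`; what remains
is a shifted grid of order `m`. -/
theorem exists_map_of_valid_false {m : ℕ} {S : Finset (ℕ × ℕ)} (hS : S ⊆ grid (m + 1))
    (h : Valid m false S) : ∃ T ⊆ grid m, T.map diagShift = S := by
  have h0 : ∀ e ∈ S, ∃ e' ∈ grid m, diagShift e' = e := by
    rintro ⟨r, s⟩ he
    have hg := mem_grid.1 (hS he)
    simp only at hg
    have hr : r / 2 < m + 1 := by omega
    have hs : s / 2 < m + 1 := by omega
    have hb := h.1 _ hr
    have hb' := h.1 _ hs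
    simp only [HalfRow, HalfCol, half_false, decide_eq_false_iff_not] at hb hb'
    have e1 : r = 2 * (r / 2) ∨ r = 2 * (r / 2) + 1 := by omega
    have e2 : s = 2 * (s / 2) ∨ s = 2 * (s / 2) + 1 := by omega
    have hr0 : r ≠ 0 := by rintro rfl; rcases e2 with e2 | e2 <;> rw [e2] at he <;> tauto
    have hr1 : r ≠ 2 * m + 1 := by rintro rfl; rcases e2 with e2 | e2 <;> rw [e2] at he <;> tauto
    have hs0 : s ≠ 0 := by rintro rfl; rcases e1 with e1 | e1 <;> rw [e1] at he <;> tauto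
    have hs1 : s ≠ 2 * m + 1 := by rintro rfl; rcases e1 with e1 | e1 <;> rw [e1] at he <;> tauto
    refine ⟨(r - 1, s - 1), mem_grid.2 ?_, ?_⟩
    · simp only
      omega
    · simp only [diagShift_apply, Prod.mk.injEq]
      omega
  obtain ⟨T, hT, hTS⟩ := (Finset.subset_map_iff (f := diagShift) (t := grid m) (s := S)).1
    fun e he => Finset.mem_map.2 (h0 e he)
  exact ⟨T, hT, hTS.symm⟩

open scoped Classical in
theorem sum_valid_true (m : ℕ) (w : ℕ × ℕ → ℝ) :
    ∑ S ∈ (grid (m + 1)).powerset.filter (Valid m true), ∏ e ∈ S, w e = Z (m + 1) w := by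
  rw [Z]
  refine Finset.sum_congr (Finset.filter_congr fun S hS => ?_) fun _ _ => rfl
  exact (isMatching_iff_valid (Finset.mem_powerset.1 hS)).symm

open scoped Classical in
theorem sum_valid_false (m : ℕ) (w : ℕ × ℕ → ℝ) :
    ∑ S ∈ (grid (m + 1)).powerset.filter (Valid m false), ∏ e ∈ S, w e =
      Z m (fun e => w (e.1 + 1, e.2 + 1)) := by
  symm
  rw [Z]
  refine Finset.sum_bij (fun S _ => S.map diagShift) ?_ ?_ ?_ ?_
  · intro S hS
    simp only [Finset.mem_filter, Finset.mem_powerset] at hS ⊢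
    refine ⟨fun e he => ?_, (isMatching_iff_valid_map hS.1).1 hS.2⟩
    obtain ⟨e, he', rfl⟩ := Finset.mem_map.1 he
    have := mem_grid.1 (hS.1 he')
    simp only [mem_grid, diagShift_apply]
    omega
  · exact fun S _ S' _ h => Finset.map_injective _ h
  · intro S hS
    simp only [Finset.mem_filter, Finset.mem_powerset] at hS
    obtain ⟨T, hT, rfl⟩ := exists_map_of_valid_false hS.1 hS.2
    exact ⟨T, by simpa using ⟨hT, (isMatching_iff_valid_map hT).2 hS.2⟩, rfl⟩
  · intro S _
    rw [Finset.prod_map]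
    rfl

/-- The reduction of the order of the Aztec diamond graph by complementation. -/
theorem Z_reduction (m : ℕ) (w : ℕ × ℕ → ℝ)
    (hw : ∀ i < m + 1, ∀ j < m + 1, cellDelta w (i, j) ≠ 0) :
    Z (m + 1) w =
      (∏ i ∈ Finset.range (m + 1), ∏ j ∈ Finset.range (m + 1), cellDelta w (i, j)) *
        Z m (fun e => dual w (e.1 + 1, e.2 + 1)) := by
  rw [← sum_valid_true, ← sum_valid_false, sum_valid_compl m w hw]

/-! ### The weight pattern under one and two reductions -/

/-- The array of weights `wt_C`, extended to infinitely many blocks. -/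
noncomputable def wtC (a b c d : ℕ → ℝ) (e : ℕ × ℕ) : ℝ :=
  blockA a b c d (e.2 / 2 + 1) ⟨e.1 % 4, Nat.mod_lt _ (by norm_num)⟩
    ⟨e.2 % 2, Nat.mod_lt _ Nat.two_pos⟩

theorem M_patternC (n : ℕ) (hp : 0 < 4) (hn : 0 < 2 * n) (a b c d : ℕ → ℝ) :
    M (p := 4) (q := 2 * n) hp hn n (patternC n a b c d) = Z n (wtC a b c d) := by
  refine (matchingGenFun_eq_Z (n := n) fun e => patternC n a b c d
    ⟨e.1 % 4, Nat.mod_lt _ hp⟩ ⟨e.2 % (2 * n), Nat.mod_lt _ hn⟩).trans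
    (Z_congr fun e he => ?_)
  simp only [patternC, wtC, Nat.mod_eq_of_lt (mem_grid.1 he).2]

/-- The weights of the Aztec diamond graph of the next smaller order. -/
noncomputable def shiftDual (w : ℕ × ℕ → ℝ) (e : ℕ × ℕ) : ℝ := dual w (e.1 + 1, e.2 + 1)

theorem shiftDual_cell (w : ℕ × ℕ → ℝ) (i j : ℕ) :
    shiftDual w (2 * i, 2 * j) = w (2 * i, 2 * j) / cellDelta w (i, j) ∧
    shiftDual w (2 * i, 2 * j + 1) = w (2 * i, 2 * (j + 1) + 1) / cellDelta w (i, j + 1) ∧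
    shiftDual w (2 * i + 1, 2 * j) = w (2 * (i + 1) + 1, 2 * j) / cellDelta w (i + 1, j) ∧
    shiftDual w (2 * i + 1, 2 * j + 1) =
      w (2 * (i + 1) + 1, 2 * (j + 1) + 1) / cellDelta w (i + 1, j + 1) :=
  ⟨(dual_cell w i j).2.2.2, (dual_cell w i (j + 1)).2.2.1, (dual_cell w (i + 1) j).2.1,
    (dual_cell w (i + 1) (j + 1)).1⟩

/-- The values of an array of weights with period `4` in the rows, on the block `j`. -/
def BlockEq (w : ℕ × ℕ → ℝ) (j : ℕ) (x₀ y₀ x₁ y₁ x₂ y₂ x₃ y₃ : ℝ) : Prop :=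
  ∀ t, (w (2 * (2 * t), 2 * j) = x₀ ∧ w (2 * (2 * t), 2 * j + 1) = y₀) ∧
    (w (2 * (2 * t) + 1, 2 * j) = x₁ ∧ w (2 * (2 * t) + 1, 2 * j + 1) = y₁) ∧
    (w (2 * (2 * t + 1), 2 * j) = x₂ ∧ w (2 * (2 * t + 1), 2 * j + 1) = y₂) ∧
    (w (2 * (2 * t + 1) + 1, 2 * j) = x₃ ∧ w (2 * (2 * t + 1) + 1, 2 * j + 1) = y₃)

theorem BlockEq.cellDelta_even {w : ℕ × ℕ → ℝ} {j : ℕ} {x₀ y₀ x₁ y₁ x₂ y₂ x₃ y₃ : ℝ}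
    (h : BlockEq w j x₀ y₀ x₁ y₁ x₂ y₂ x₃ y₃) (t : ℕ) :
    cellDelta w (2 * t, j) = x₀ * y₁ + y₀ * x₁ := by
  simp only [cellDelta, (h t).1, (h t).2.1]

theorem BlockEq.cellDelta_odd {w : ℕ × ℕ → ℝ} {j : ℕ} {x₀ y₀ x₁ y₁ x₂ y₂ x₃ y₃ : ℝ}
    (h : BlockEq w j x₀ y₀ x₁ y₁ x₂ y₂ x₃ y₃) (t : ℕ) :
    cellDelta w (2 * t + 1, j) = x₂ * y₃ + y₂ * x₃ := by
  simp only [cellDelta, (h t).2.2]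

theorem BlockEq.shiftDual {w : ℕ × ℕ → ℝ} {j : ℕ} {x₀ y₀ x₁ y₁ x₂ y₂ x₃ y₃ : ℝ}
    {z₀ v₀ z₁ v₁ z₂ v₂ z₃ v₃ : ℝ}
    (h : BlockEq w j x₀ y₀ x₁ y₁ x₂ y₂ x₃ y₃) (h' : BlockEq w (j + 1) z₀ v₀ z₁ v₁ z₂ v₂ z₃ v₃) :
    BlockEq (shiftDual w) j
      (x₀ / (x₀ * y₁ + y₀ * x₁)) (v₀ / (z₀ * v₁ + v₀ * z₁))
      (x₃ / (x₂ * y₃ + y₂ * x₃)) (v₃ / (z₂ * v₃ + v₂ * z₃))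
      (x₂ / (x₂ * y₃ + y₂ * x₃)) (v₂ / (z₂ * v₃ + v₂ * z₃))
      (x₁ / (x₀ * y₁ + y₀ * x₁)) (v₁ / (z₀ * v₁ + v₀ * z₁)) := by
  intro t
  obtain ⟨a1, a2, a3, a4⟩ := shiftDual_cell w (2 * t) j
  obtain ⟨b1, b2, b3, b4⟩ := shiftDual_cell w (2 * t + 1) j
  -- The last row of a period takes its weights from the first cell row of the next period.
  have e : 2 * t + 1 + 1 = 2 * (t + 1) := by ring
  rw [e] at b3 b4
  simp only [a1, a2, a3, a4, b1, b2, b3, b4, h.cellDelta_even, h.cellDelta_odd,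
    h'.cellDelta_even, h'.cellDelta_odd, h t, h' t, h (t + 1), h' (t + 1), and_self]

theorem wtC_blockEq (a b c d : ℕ → ℝ) (j : ℕ) :
    BlockEq (wtC a b c d) j (a (j + 1)) (b (j + 1)) (d (j + 1)) (c (j + 1))
      (d (j + 1) / Delta a b c d (j + 1)) (c (j + 1) / Delta a b c d (j + 1))
      (a (j + 1) / Delta a b c d (j + 1)) (b (j + 1) / Delta a b c d (j + 1)) := by
  intro t
  have h0 : 2 * (2 * t) % 4 = 0 := by omega
  have h1 : (2 * (2 * t) + 1) % 4 = 1 := by omega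
  have h2 : 2 * (2 * t + 1) % 4 = 2 := by omega
  have h3 : (2 * (2 * t + 1) + 1) % 4 = 3 := by omega
  have h4 : 2 * j / 2 = j := by omega
  have h5 : (2 * j + 1) / 2 = j := by omega
  have h6 : (2 * j + 1) % 2 = 1 := by omega
  have h7 : 2 * j % 2 = 0 := by omega
  simp only [wtC, h0, h1, h2, h3, h4, h5, h6, h7]
  exact ⟨⟨rfl, rfl⟩, ⟨rfl, rfl⟩, ⟨rfl, rfl⟩, rfl, rfl⟩

theorem BlockEq.congr {w : ℕ × ℕ → ℝ} {j : ℕ} {x₀ y₀ x₁ y₁ x₂ y₂ x₃ y₃ : ℝ}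
    {z₀ v₀ z₁ v₁ z₂ v₂ z₃ v₃ : ℝ} (h : BlockEq w j x₀ y₀ x₁ y₁ x₂ y₂ x₃ y₃)
    (e₀ : x₀ = z₀) (f₀ : y₀ = v₀) (e₁ : x₁ = z₁) (f₁ : y₁ = v₁)
    (e₂ : x₂ = z₂) (f₂ : y₂ = v₂) (e₃ : x₃ = z₃) (f₃ : y₃ = v₃) :
    BlockEq w j z₀ v₀ z₁ v₁ z₂ v₂ z₃ v₃ := by
  subst e₀ f₀ e₁ f₁ e₂ f₂ e₃ f₃
  exact h

/-- The cells of block `i` have delta `Δ_i` in even cell rows and `1/Δ_i` in odd ones. The shift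
pairs the left column of one block with the right column of the next. -/
theorem wtC_shiftDual (a b c d : ℕ → ℝ) (j : ℕ) (h : Delta a b c d (j + 1) ≠ 0)
    (h' : Delta a b c d (j + 2) ≠ 0) :
    BlockEq (shiftDual (wtC a b c d)) j
      (a (j + 1) / Delta a b c d (j + 1)) (b (j + 2) / Delta a b c d (j + 2))
      (a (j + 1)) (b (j + 2)) (d (j + 1)) (c (j + 2))
      (d (j + 1) / Delta a b c d (j + 1)) (c (j + 2) / Delta a b c d (j + 2)) := by
  have key : ∀ i, Delta a b c d i ≠ 0 →
      d i / Delta a b c d i * (b i / Delta a b c d i) +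
        c i / Delta a b c d i * (a i / Delta a b c d i) = (Delta a b c d i)⁻¹ := by
    intro i hi
    field_simp
    simp only [Delta]
    ring
  have key' : ∀ i, a i * c i + b i * d i = Delta a b c d i := fun i => rfl
  refine ((wtC_blockEq a b c d j).shiftDual (wtC_blockEq a b c d (j + 1))).congr
    ?_ ?_ ?_ ?_ ?_ ?_ ?_ ?_ <;> simp only [key _ h, key _ h', key'] <;> field_simp

/-- The intermediate cells have delta `a_i b_{i+1}` or `d_i c_{i+1}` times `(Δ_i + Δ_{i+1})/(Δ_i
Δ_{i+1})`. Dividing by it cancels the letters of the outer blocks, leaving only the middle block's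
letters. -/
theorem wtC_shiftDual_shiftDual (a b c d : ℕ → ℝ) (j : ℕ)
    (h : ∀ i ∈ Finset.Icc (j + 1) (j + 3), 0 < a i ∧ 0 < b i ∧ 0 < c i ∧ 0 < d i) :
    BlockEq (shiftDual (shiftDual (wtC a b c d))) j
      (Delta a b c d (j + 2) / (b (j + 2) * (Delta a b c d (j + 1) + Delta a b c d (j + 2))))
      (Delta a b c d (j + 2) / (a (j + 2) * (Delta a b c d (j + 2) + Delta a b c d (j + 3))))
      (Delta a b c d (j + 2) / (c (j + 2) * (Delta a b c d (j + 1) + Delta a b c d (j + 2))))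
      (Delta a b c d (j + 2) / (d (j + 2) * (Delta a b c d (j + 2) + Delta a b c d (j + 3))))
      (Delta a b c d (j + 1) * Delta a b c d (j + 2) /
        (c (j + 2) * (Delta a b c d (j + 1) + Delta a b c d (j + 2))))
      (Delta a b c d (j + 2) * Delta a b c d (j + 3) /
        (d (j + 2) * (Delta a b c d (j + 2) + Delta a b c d (j + 3))))
      (Delta a b c d (j + 1) * Delta a b c d (j + 2) /
        (b (j + 2) * (Delta a b c d (j + 1) + Delta a b c d (j + 2))))
      (Delta a b c d (j + 2) * Delta a b c d (j + 3) /
        (a (j + 2) * (Delta a b c d (j + 2) + Delta a b c d (j + 3)))) := by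
  have hΔ : ∀ i ∈ Finset.Icc (j + 1) (j + 3), 0 < Delta a b c d i := fun i hi => by
    obtain ⟨h1, h2, h3, h4⟩ := h i hi
    unfold Delta
    positivity
  have m1 : j + 1 ∈ Finset.Icc (j + 1) (j + 3) := by simp
  have m2 : j + 2 ∈ Finset.Icc (j + 1) (j + 3) := by simp
  have m3 : j + 3 ∈ Finset.Icc (j + 1) (j + 3) := by simp
  obtain ⟨a1, b1, c1, d1⟩ := h _ m1
  obtain ⟨a2, b2, c2, d2⟩ := h _ m2
  obtain ⟨a3, b3, c3, d3⟩ := h _ m3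
  have e1 := hΔ _ m1
  have e2 := hΔ _ m2
  have e3 := hΔ _ m3
  refine ((wtC_shiftDual a b c d j e1.ne' e2.ne').shiftDual
    (wtC_shiftDual a b c d (j + 1) e2.ne' e3.ne')).congr ?_ ?_ ?_ ?_ ?_ ?_ ?_ ?_
  all_goals
    try simp only [show j + 1 + 1 = j + 2 from rfl, show j + 1 + 2 = j + 3 from rfl]
    generalize Delta a b c d (j + 1) = x at *
    generalize Delta a b c d (j + 2) = y at *
    generalize Delta a b c d (j + 3) = z at *
    field_simp
    try ring

/-! ### The recursion lowering the order by two -/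

theorem prod_range_alternating {G : ℕ → ℝ} {x y : ℝ} (h₀ : ∀ t, G (2 * t) = x)
    (h₁ : ∀ t, G (2 * t + 1) = y) (n : ℕ) :
    ∏ i ∈ Finset.range n, G i = x ^ ((n + 1) / 2) * y ^ (n / 2) := by
  induction n with
  | zero => simp
  | succ n ih =>
    rw [Finset.prod_range_succ, ih]
    obtain ⟨t, rfl | rfl⟩ : ∃ t, n = 2 * t ∨ n = 2 * t + 1 := ⟨n / 2, by omega⟩
    · rw [h₀, show (2 * t + 1) / 2 = t by omega, show 2 * t / 2 = t by omega,
        show (2 * t + 1 + 1) / 2 = t + 1 by omega]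
      ring
    · rw [h₁, show (2 * t + 1) / 2 = t by omega, show (2 * t + 1 + 1) / 2 = t + 1 by omega,
        show (2 * t + 1 + 1 + 1) / 2 = t + 1 by omega]
      ring

theorem prod_rows_alternating {F : ℕ → ℕ → ℝ} {x y : ℕ → ℝ} {m : ℕ}
    (h₀ : ∀ t, ∀ j < m, F (2 * t) j = x j) (h₁ : ∀ t, ∀ j < m, F (2 * t + 1) j = y j) (n : ℕ) :
    ∏ i ∈ Finset.range n, ∏ j ∈ Finset.range m, F i j =
      (∏ j ∈ Finset.range m, x j) ^ ((n + 1) / 2) * (∏ j ∈ Finset.range m, y j) ^ (n / 2) :=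
  prod_range_alternating
    (fun t => Finset.prod_congr rfl fun j hj => h₀ t j (Finset.mem_range.1 hj))
    (fun t => Finset.prod_congr rfl fun j hj => h₁ t j (Finset.mem_range.1 hj)) n

/-- The factors at the vertices `(2i, 2j+1)` that relate the twice reduced weights to the
original ones. -/
noncomputable def blackGauge (a b c d : ℕ → ℝ) (i j : ℕ) : ℝ :=
  if i % 2 = 0 then Delta a b c d (j + 2) / (a (j + 2) * b (j + 2))
  else Delta a b c d (j + 2) / (c (j + 2) * d (j + 2))

/-- The factors at the vertices `(2i+1, 2j)` that relate the twice reduced weights to the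
original ones. -/
noncomputable def whiteGauge (a b c d : ℕ → ℝ) (i j : ℕ) : ℝ :=
  if i % 2 = 0 then 1 / (Delta a b c d (j + 1) + Delta a b c d (j + 2))
  else Delta a b c d (j + 1) * Delta a b c d (j + 2) /
    (Delta a b c d (j + 1) + Delta a b c d (j + 2))

theorem Delta_pos {a b c d : ℕ → ℝ} {i : ℕ} (h : 0 < a i ∧ 0 < b i ∧ 0 < c i ∧ 0 < d i) :
    0 < Delta a b c d i := by
  obtain ⟨h1, h2, h3, h4⟩ := h
  unfold Delta
  positivity

theorem shiftDual_shiftDual_wtC {N : ℕ} {a b c d : ℕ → ℝ}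
    (h : ∀ i ∈ Finset.Icc 1 (N + 2), 0 < a i ∧ 0 < b i ∧ 0 < c i ∧ 0 < d i)
    {e : ℕ × ℕ} (he : e ∈ grid N) :
    shiftDual (shiftDual (wtC a b c d)) e =
      blackGauge a b c d ((e.1 + 1) / 2) (e.2 / 2) * whiteGauge a b c d (e.1 / 2) ((e.2 + 1) / 2) *
        wtC (fun i => a (i + 1)) (fun i => b (i + 1)) (fun i => c (i + 1)) (fun i => d (i + 1))
          e := by
  obtain ⟨r, s⟩ := e
  obtain ⟨j, hs⟩ : ∃ j, s = 2 * j ∨ s = 2 * j + 1 := ⟨s / 2, by omega⟩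
  obtain ⟨t, hr⟩ : ∃ t, r = 2 * (2 * t) ∨ r = 2 * (2 * t) + 1 ∨ r = 2 * (2 * t + 1) ∨
    r = 2 * (2 * t + 1) + 1 := ⟨r / 4, by omega⟩
  have hj : j < N := by
    have := mem_grid.1 he
    simp only at this
    omega
  have hpos : ∀ i ∈ Finset.Icc (j + 1) (j + 3), 0 < a i ∧ 0 < b i ∧ 0 < c i ∧ 0 < d i :=
    fun i hi => h i (by simp only [Finset.mem_Icc] at hi ⊢; omega)
  have H := wtC_shiftDual_shiftDual a b c d j hpos t
  have H' := wtC_blockEq (fun i => a (i + 1)) (fun i => b (i + 1)) (fun i => c (i + 1))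
    (fun i => d (i + 1)) j t
  have hD : Delta (fun i => a (i + 1)) (fun i => b (i + 1)) (fun i => c (i + 1))
    (fun i => d (i + 1)) (j + 1) = Delta a b c d (j + 2) := rfl
  obtain ⟨a2, b2, c2, d2⟩ := hpos (j + 2) (by simp)
  have e1 := Delta_pos (hpos (j + 1) (by simp))
  have e2 := Delta_pos (hpos (j + 2) (by simp))
  have e3 := Delta_pos (hpos (j + 3) (by simp))
  have h0 : ∀ i, 2 * i / 2 = i := fun i => by omega
  have h1 : ∀ i, (2 * i + 1) / 2 = i := fun i => by omega
  have h2 : ∀ i, (2 * i + 1) % 2 = 1 := fun i => by omega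
  have h3 : ∀ i, (2 * i + 1 + 1) / 2 = i + 1 := fun i => by omega
  have h4 : ∀ i, (2 * i + 1 + 1) % 2 = 0 := fun i => by omega
  have h5 : ∀ i, (2 * i) % 2 = 0 := fun i => by omega
  rcases hr with rfl | rfl | rfl | rfl <;> rcases hs with rfl | rfl <;>
    simp only [H, H', hD, h0, h1, h2, h3, h4, h5, blackGauge, whiteGauge, if_true, if_false,
      one_ne_zero] <;>
    generalize Delta a b c d (j + 1) = x at * <;>
    generalize Delta a b c d (j + 2) = y at * <;>
    generalize Delta a b c d (j + 3) = z at * <;>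
    field_simp

theorem prod_range_succ_shift (f : ℕ → ℝ) (N : ℕ) :
    ∏ j ∈ Finset.range (N + 1), f (j + 1) = f 1 * ∏ j ∈ Finset.range N, f (j + 2) := by
  rw [Finset.prod_range_succ', mul_comm]

/-- `A`, `B`, `C`, `F`, `E` are the products of the inner `a`, `b`, `c`, `d`, `Δ`; `S` is the
product of all sums `Δ_i + Δ_{i+1}`; `x`, `y` are the two extreme `Δ`. The idea is to collect one
factor of each kind into `hbase`, where the inner products cancel; `hrest` holds the factors left
over by the parity of the order. -/
theorem reduction_factor_identity {k q : ℕ} (hq : q = k ∨ q = k + 1)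
    {A B C F E S x y : ℝ} (a b c d z : ℝ) (hA : A ≠ 0) (hB : B ≠ 0) (hC : C ≠ 0) (hF : F ≠ 0)
    (hE : E ≠ 0) (hS : S ≠ 0) (hx : x ≠ 0) (hy : y ≠ 0) :
    (x * (E * y)) ^ (q + 1) * ((x * (E * y))⁻¹) ^ (k + 1) *
      ((a * A * (B * b) * S / (x * E * (E * y))) ^ (k + 1) *
        (d * F * (C * c) * S / (x * E * (E * y))) ^ q *
      ((E / (A * B)) ^ (k + 1) * (E / (C * F)) ^ q *
        ((1 / S) ^ q * (x * E * (E * y) / S) ^ k) * z)) =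
    a ^ (k + 1) * b ^ (k + 1) * c ^ q * d ^ q * ((x * y) ^ (k + 1) * E)⁻¹ * S * z := by
  have hbase : (x * (E * y)) * (x * (E * y))⁻¹ * (a * A * (B * b) * S / (x * E * (E * y))) *
      (d * F * (C * c) * S / (x * E * (E * y))) * (E / (A * B)) * (E / (C * F)) * (1 / S) *
      (x * E * (E * y) / S) = a * b * c * d * (x * y)⁻¹ := by
    field_simp
  rcases hq with rfl | rfl
  · have hrest : (x * (E * y)) * (x * (E * y))⁻¹ * (a * A * (B * b) * S / (x * E * (E * y))) *
        (E / (A * B)) = a * b * (x * y)⁻¹ * E⁻¹ * S := by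
      field_simp
    calc _ = (a * b * c * d * (x * y)⁻¹) ^ q * (a * b * (x * y)⁻¹ * E⁻¹ * S) * z := by
          rw [← hbase, ← hrest]
          generalize x * (E * y) = p₁
          generalize p₁⁻¹ = p₂
          generalize a * A * (B * b) * S / (x * E * (E * y)) = p₃
          generalize d * F * (C * c) * S / (x * E * (E * y)) = p₄
          generalize E / (A * B) = p₅
          generalize E / (C * F) = p₆
          generalize 1 / S = p₇
          generalize x * E * (E * y) / S = p₈
          ring
      _ = _ := by
          simp only [mul_pow, pow_succ, inv_pow, mul_inv]
          ac_rfl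
  · have hrest : (x * (E * y)) * (x * (E * y)) * (x * (E * y))⁻¹ *
        (a * A * (B * b) * S / (x * E * (E * y))) *
        (d * F * (C * c) * S / (x * E * (E * y))) * (E / (A * B)) * (E / (C * F)) * (1 / S) =
        a * b * c * d * (x * y)⁻¹ * E⁻¹ * S := by
      field_simp
    calc _ = (a * b * c * d * (x * y)⁻¹) ^ k * (a * b * c * d * (x * y)⁻¹ * E⁻¹ * S) * z := by
          rw [← hrest, ← hbase]
          generalize x * (E * y) = p₁
          generalize p₁⁻¹ = p₂
          generalize a * A * (B * b) * S / (x * E * (E * y)) = p₃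
          generalize d * F * (C * c) * S / (x * E * (E * y)) = p₄
          generalize E / (A * B) = p₅
          generalize E / (C * F) = p₆
          generalize 1 / S = p₇
          generalize x * E * (E * y) / S = p₈
          ring
      _ = _ := by
          simp only [mul_pow, pow_succ, inv_pow, mul_inv]
          ac_rfl

/-- The reduction of the order of the Aztec diamond graph by two. -/
theorem Z_wtC_add_two {k q : ℕ} (hq : q = k ∨ q = k + 1) {a b c d : ℕ → ℝ}
    (h : ∀ i ∈ Finset.Icc 1 (k + q + 2), 0 < a i ∧ 0 < b i ∧ 0 < c i ∧ 0 < d i) :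
    Z (k + q + 2) (wtC a b c d) =
      a 1 ^ (k + 1) * b (k + q + 2) ^ (k + 1) * c (k + q + 2) ^ q * d 1 ^ q *
        ((Delta a b c d 1 * Delta a b c d (k + q + 2)) ^ (k + 1) *
          ∏ j ∈ Finset.range (k + q), Delta a b c d (j + 2))⁻¹ *
        (∏ j ∈ Finset.range (k + q + 1), (Delta a b c d (j + 1) + Delta a b c d (j + 2))) *
        Z (k + q) (wtC (fun i => a (i + 1)) (fun i => b (i + 1)) (fun i => c (i + 1))
          (fun i => d (i + 1))) := by
  obtain ⟨N, hN⟩ : ∃ N, N = k + q := ⟨_, rfl⟩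
  rw [← hN] at h ⊢
  set D := Delta a b c d with hDdef
  have hΔ : ∀ i ∈ Finset.Icc 1 (N + 2), 0 < D i := fun i hi => Delta_pos (h i hi)
  have hmem : ∀ {i}, 1 ≤ i → i ≤ N + 2 → i ∈ Finset.Icc 1 (N + 2) := fun h1 h2 =>
    Finset.mem_Icc.2 ⟨h1, h2⟩
  have hD0 : ∀ j < N + 2, D (j + 1) ≠ 0 := fun j hj => (hΔ _ (hmem (by omega) (by omega))).ne'
  have hc0 : ∀ t, ∀ j < N + 2, cellDelta (wtC a b c d) (2 * t, j) = D (j + 1) := fun t j _ =>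
    (wtC_blockEq a b c d j).cellDelta_even t
  have hc1 : ∀ t, ∀ j < N + 2, cellDelta (wtC a b c d) (2 * t + 1, j) = (D (j + 1))⁻¹ :=
    fun t j hj => by
      rw [(wtC_blockEq a b c d j).cellDelta_odd t]
      have := hD0 j hj
      rw [← hDdef]
      field_simp
      simp only [hDdef, Delta]
      ring
  have hd0 : ∀ t, ∀ j < N + 1, cellDelta (shiftDual (wtC a b c d)) (2 * t, j) =
      a (j + 1) * b (j + 2) * (D (j + 1) + D (j + 2)) / (D (j + 1) * D (j + 2)) :=
    fun t j hj => by
      have h1 := hD0 j (by omega)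
      have h2 := hD0 (j + 1) (by omega)
      rw [(wtC_shiftDual a b c d j h1 h2).cellDelta_even t, ← hDdef]
      field_simp
      ring
  have hd1 : ∀ t, ∀ j < N + 1, cellDelta (shiftDual (wtC a b c d)) (2 * t + 1, j) =
      d (j + 1) * c (j + 2) * (D (j + 1) + D (j + 2)) / (D (j + 1) * D (j + 2)) :=
    fun t j hj => by
      have h1 := hD0 j (by omega)
      have h2 := hD0 (j + 1) (by omega)
      rw [(wtC_shiftDual a b c d j h1 h2).cellDelta_odd t, ← hDdef]
      field_simp
  have hS : ∀ j < N + 1, 0 < D (j + 1) + D (j + 2) := fun j hj =>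
    add_pos (hΔ _ (hmem (by omega) (by omega))) (hΔ _ (hmem (by omega) (by omega)))
  have even_or : ∀ i, (∃ t, i = 2 * t) ∨ ∃ t, i = 2 * t + 1 := fun i => by
    rcases Nat.mod_two_eq_zero_or_one i with h | h
    · exact Or.inl ⟨i / 2, by omega⟩
    · exact Or.inr ⟨i / 2, by omega⟩
  rw [show N + 2 = N + 1 + 1 from rfl, Z_reduction (N + 1) _ fun i _ j hj => ?_,
    show (fun e : ℕ × ℕ => dual (wtC a b c d) (e.1 + 1, e.2 + 1)) = shiftDual (wtC a b c d) from rfl,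
    Z_reduction N _ fun i _ j hj => ?_,
    show (fun e : ℕ × ℕ => dual (shiftDual (wtC a b c d)) (e.1 + 1, e.2 + 1)) =
      shiftDual (shiftDual (wtC a b c d)) from rfl,
    Z_congr fun e he => shiftDual_shiftDual_wtC h he, Z_gauge,
    prod_rows_alternating hc0 hc1, prod_rows_alternating hd0 hd1,
    prod_rows_alternating (F := blackGauge a b c d) (fun t j _ => if_pos (by omega))
      (fun t j _ => if_neg (by omega)),
    prod_rows_alternating (F := whiteGauge a b c d) (fun t j _ => if_pos (by omega))
      (fun t j _ => if_neg (by omega))]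
  -- Here `q` and `k` are `N/2` rounded up and down; the exponents count the rows of even and odd
  -- index.
  · rw [show (N + 1 + 1 + 1) / 2 = q + 1 by omega, show (N + 1 + 1) / 2 = k + 1 by omega,
      show (N + 1) / 2 = q by omega, show N / 2 = k by omega]
    -- Intermediate cells involve `a`, `d` of one block and `b`, `c` of the next, so the first index
    -- is split off for `a`, `d` and the last for `b`, `c`.
    simp only [← hDdef, Finset.prod_mul_distrib, Finset.prod_div_distrib, Finset.prod_inv_distrib,
      Finset.prod_const_one, prod_range_succ_shift a, prod_range_succ_shift d,
      prod_range_succ_shift D, Finset.prod_range_succ (fun j => b (j + 2)),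
      Finset.prod_range_succ (fun j => c (j + 2)), Finset.prod_range_succ (fun j => D (j + 2))]
    have pne : ∀ f : ℕ → ℝ, (∀ i ∈ Finset.Icc 1 (N + 2), 0 < f i) →
        (∏ j ∈ Finset.range N, f (j + 2)) ≠ 0 := fun f hf =>
      (Finset.prod_pos fun j hj => hf _ (hmem (by omega) (by
        have := Finset.mem_range.1 hj
        omega))).ne'
    have hA := pne a fun i hi => (h i hi).1
    have hB := pne b fun i hi => (h i hi).2.1
    have hC := pne c fun i hi => (h i hi).2.2.1
    have hd := pne d fun i hi => (h i hi).2.2.2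
    have hE := pne D hΔ
    have hSS : (∏ j ∈ Finset.range (N + 1), (D (j + 1) + D (j + 2))) ≠ 0 :=
      (Finset.prod_pos fun j hj => hS j (Finset.mem_range.1 hj)).ne'
    have hD1 := hD0 0 (by omega)
    have hDn := hD0 (N + 1) (by omega)
    simp only [zero_add, show N + 1 + 1 = N + 2 from rfl] at hD1 hDn ⊢
    generalize (∏ j ∈ Finset.range N, a (j + 2)) = A at *
    generalize (∏ j ∈ Finset.range N, b (j + 2)) = B at *
    generalize (∏ j ∈ Finset.range N, c (j + 2)) = C at *
    generalize (∏ j ∈ Finset.range N, d (j + 2)) = F at *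
    generalize (∏ j ∈ Finset.range N, D (j + 2)) = E at *
    generalize (∏ j ∈ Finset.range (N + 1), (D (j + 1) + D (j + 2))) = S at *
    generalize D 1 = x at *
    generalize D (N + 2) = y at *
    exact reduction_factor_identity hq _ _ _ _ _ hA hB hC hd hE hSS hD1 hDn
  · have h1 := h (j + 1) (hmem (by omega) (by omega))
    have h2 := h (j + 2) (hmem (by omega) (by omega))
    have := hS j hj
    have := hΔ (j + 1) (hmem (by omega) (by omega))
    have := hΔ (j + 2) (hmem (by omega) (by omega))
    obtain ⟨_, _, _, _⟩ := h1
    obtain ⟨_, _, _, _⟩ := h2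
    rcases even_or i with ⟨t, rfl⟩ | ⟨t, rfl⟩
    · rw [hd0 t j hj]; positivity
    · rw [hd1 t j hj]; positivity
  · rcases even_or i with ⟨t, rfl⟩ | ⟨t, rfl⟩
    · rw [hc0 t j hj]; exact hD0 j hj
    · rw [hc1 t j hj]; exact inv_ne_zero (hD0 j hj)

/-! ### Solving the recursion -/

theorem prod_Icc_one (k : ℕ) (f : ℕ → ℝ) :
    ∏ i ∈ Finset.Icc 1 k, f i = ∏ i ∈ Finset.range k, f (i + 1) := by
  induction k with
  | zero => simp
  | succ k ih => rw [Finset.prod_Icc_succ_top (by omega), ih, Finset.prod_range_succ]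

/-- Supplies the induction step for the sums of `Δ`: raising the indices lowers each exponent by
one, and the recursion contributes the missing factor. -/
theorem prod_range_pow_succ (U : ℕ → ℝ) (k : ℕ) :
    ∏ i ∈ Finset.range k, U i ^ (i + 1) =
      (∏ i ∈ Finset.range (k - 1), U (i + 1) ^ (i + 1)) * ∏ i ∈ Finset.range k, U i := by
  rcases k with _ | k
  · simp
  · rw [Finset.prod_range_succ', Finset.prod_range_succ' U, Nat.add_sub_cancel, zero_add, pow_one,
      ← mul_assoc, ← Finset.prod_mul_distrib]
    exact congrArg (· * U 0) (Finset.prod_congr rfl fun i _ => pow_succ _ _)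

/-- Cuts the new factors into a left part and a right part counted from the end, as in the two
products of the formula. -/
theorem prod_range_split_reflect (S : ℕ → ℝ) (p q : ℕ) :
    ∏ j ∈ Finset.range (p + q), S j =
      (∏ i ∈ Finset.range p, S i) * ∏ i ∈ Finset.range q, S (p + q - 1 - i) := by
  rw [Finset.prod_range_add, ← Finset.prod_range_reflect (fun j => S (p + j))]
  refine congrArg _ (Finset.prod_congr rfl fun i hi => ?_)
  have := Finset.mem_range.1 hi
  congr 1
  omega

theorem prod_zpow_neg_succ (D : ℕ → ℝ) (n k : ℕ) :
    ∏ i ∈ Finset.Icc 1 (n + 2), D i ^ (-((k + 1 : ℕ) : ℤ)) =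
      (∏ i ∈ Finset.Icc 1 n, D (i + 1) ^ (-(k : ℤ))) *
        ((D 1 * D (n + 2)) ^ (k + 1) * ∏ j ∈ Finset.range n, D (j + 2))⁻¹ := by
  simp only [prod_Icc_one, zpow_neg, zpow_natCast, Finset.prod_inv_distrib]
  rw [← mul_inv, Finset.prod_range_succ, Finset.prod_range_succ']
  simp only [pow_succ, Finset.prod_mul_distrib, zero_add]
  congr 1
  ring

theorem Z_wtC_even (k : ℕ) (a b c d : ℕ → ℝ)
    (h : ∀ i ∈ Finset.Icc 1 (2 * k), 0 < a i ∧ 0 < b i ∧ 0 < c i ∧ 0 < d i) :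
    Z (2 * k) (wtC a b c d) =
      (∏ i ∈ Finset.Icc 1 k,
          a i ^ (k + 1 - i) * b (2 * k + 1 - i) ^ (k + 1 - i) *
            c (2 * k + 1 - i) ^ (k - i) * d i ^ (k - i)) *
        (∏ i ∈ Finset.Icc 1 (2 * k), Delta a b c d i ^ (-(k : ℤ))) *
        (∏ i ∈ Finset.Icc 1 (k - 1), (Delta a b c d i + Delta a b c d (i + 1)) ^ i) *
        (∏ i ∈ Finset.Icc 1 k,
          (Delta a b c d (2 * k - i) + Delta a b c d (2 * k + 1 - i)) ^ i) := by
  induction k generalizing a b c d with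
  | zero => simp [Z_zero]
  | succ k ih =>
    have ih' := ih (fun i => a (i + 1)) (fun i => b (i + 1)) (fun i => c (i + 1))
      (fun i => d (i + 1)) fun i hi => h (i + 1) (by simp only [Finset.mem_Icc] at hi ⊢; omega)
    have hrec := Z_wtC_add_two (k := k) (q := k) (Or.inl rfl) (a := a) (b := b) (c := c) (d := d)
      fun i hi => h i (by simp only [Finset.mem_Icc] at hi ⊢; omega)
    rw [← two_mul, ih'] at hrec
    have hD : ∀ i, Delta (fun i => a (i + 1)) (fun i => b (i + 1)) (fun i => c (i + 1))
      (fun i => d (i + 1)) i = Delta a b c d (i + 1) := fun _ => rfl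
    simp only [hD] at hrec
    rw [show 2 * (k + 1) = 2 * k + 2 by ring, hrec, prod_zpow_neg_succ]
    generalize Delta a b c d = D
    have T1 : (∏ i ∈ Finset.Icc 1 (k + 1), a i ^ (k + 1 + 1 - i) *
        b (2 * k + 2 + 1 - i) ^ (k + 1 + 1 - i) *
          c (2 * k + 2 + 1 - i) ^ (k + 1 - i) * d i ^ (k + 1 - i)) =
        (∏ i ∈ Finset.Icc 1 k, a (i + 1) ^ (k + 1 - i) * b (2 * k + 1 - i + 1) ^ (k + 1 - i) *
            c (2 * k + 1 - i + 1) ^ (k - i) * d (i + 1) ^ (k - i)) *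
        (a 1 ^ (k + 1) * b (2 * k + 2) ^ (k + 1) * c (2 * k + 2) ^ k * d 1 ^ k) := by
      rw [prod_Icc_one, prod_Icc_one, Finset.prod_range_succ']
      congr 1
      refine Finset.prod_congr rfl fun i hi => ?_
      have := Finset.mem_range.1 hi
      rw [show k + 1 + 1 - (i + 1 + 1) = k + 1 - (i + 1) by omega,
        show 2 * k + 2 + 1 - (i + 1 + 1) = 2 * k + 1 - (i + 1) + 1 by omega,
        show k + 1 - (i + 1 + 1) = k - (i + 1) by omega]
    have T3 : (∏ i ∈ Finset.Icc 1 (k + 1 - 1), (D i + D (i + 1)) ^ i) =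
        (∏ i ∈ Finset.Icc 1 (k - 1), (D (i + 1) + D (i + 1 + 1)) ^ i) *
          ∏ i ∈ Finset.range k, (D (i + 1) + D (i + 2)) := by
      rw [prod_Icc_one, prod_Icc_one, Nat.add_sub_cancel]
      exact prod_range_pow_succ (fun i => D (i + 1) + D (i + 2)) k
    have T4 : (∏ i ∈ Finset.Icc 1 (k + 1), (D (2 * k + 2 - i) + D (2 * k + 2 + 1 - i)) ^ i) =
        (∏ i ∈ Finset.Icc 1 k, (D (2 * k - i + 1) + D (2 * k + 1 - i + 1)) ^ i) *
          ∏ i ∈ Finset.range (k + 1), (D (2 * k - i + 1) + D (2 * k - i + 2)) := by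
      rw [prod_Icc_one, prod_Icc_one]
      refine Eq.trans (Finset.prod_congr rfl fun i hi => ?_) ((prod_range_pow_succ
        (fun i => D (2 * k - i + 1) + D (2 * k - i + 2)) (k + 1)).trans ?_)
      · have := Finset.mem_range.1 hi
        rw [show 2 * k + 2 - (i + 1) = 2 * k - i + 1 by omega,
          show 2 * k + 2 + 1 - (i + 1) = 2 * k - i + 2 by omega]
      · rw [Nat.add_sub_cancel]
        congr 1
        refine Finset.prod_congr rfl fun i hi => ?_
        have := Finset.mem_range.1 hi
        rw [show 2 * k - (i + 1) + 2 = 2 * k + 1 - (i + 1) + 1 by omega]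
    -- There is an odd number of sums; the middle one, `Δ_{k+1} + Δ_{k+2}`, belongs to the right
    -- part.
    have TS : (∏ j ∈ Finset.range (2 * k + 1), (D (j + 1) + D (j + 2))) =
        (∏ i ∈ Finset.range k, (D (i + 1) + D (i + 2))) *
          ∏ i ∈ Finset.range (k + 1), (D (2 * k - i + 1) + D (2 * k - i + 2)) := by
      rw [show 2 * k + 1 = k + (k + 1) by ring,
        prod_range_split_reflect (fun j => D (j + 1) + D (j + 2)),
        show k + (k + 1) - 1 = 2 * k by omega]
    rw [T1, T3, T4, TS]
    ring

theorem Z_one (w : ℕ × ℕ → ℝ) (hw : cellDelta w (0, 0) ≠ 0) : Z 1 w = cellDelta w (0, 0) := by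
  rw [Z_reduction 0 w fun i hi j hj => ?_, Z_zero]
  · simp
  · obtain rfl : i = 0 := by omega
    obtain rfl : j = 0 := by omega
    exact hw

theorem Z_wtC_odd (k : ℕ) (a b c d : ℕ → ℝ)
    (h : ∀ i ∈ Finset.Icc 1 (2 * k + 1), 0 < a i ∧ 0 < b i ∧ 0 < c i ∧ 0 < d i) :
    Z (2 * k + 1) (wtC a b c d) =
      (∏ i ∈ Finset.Icc 1 (k + 1),
          a i ^ (k + 1 - i) * b (2 * k + 2 - i) ^ (k + 1 - i) *
            c (2 * k + 2 - i) ^ (k + 1 - i) * d i ^ (k + 1 - i)) *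
        Delta a b c d (k + 1) *
        (∏ i ∈ Finset.Icc 1 (2 * k + 1), Delta a b c d i ^ (-(k : ℤ))) *
        (∏ i ∈ Finset.Icc 1 k, (Delta a b c d i + Delta a b c d (i + 1)) ^ i) *
        (∏ i ∈ Finset.Icc 1 k,
          (Delta a b c d (2 * k + 1 - i) + Delta a b c d (2 * k + 2 - i)) ^ i) := by
  induction k generalizing a b c d with
  | zero =>
    -- Order one is a single cell of weight `Δ_1`; the index shifts of the induction turn it into
    -- the isolated factor `Δ_{k+1}`.
    have h1 := Delta_pos (h 1 (by simp))
    have h2 : cellDelta (wtC a b c d) (0, 0) = Delta a b c d 1 :=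
      (wtC_blockEq a b c d 0).cellDelta_even 0
    rw [mul_zero, zero_add, Z_one _ (h2 ▸ h1.ne'), h2]
    simp
  | succ k ih =>
    have ih' := ih (fun i => a (i + 1)) (fun i => b (i + 1)) (fun i => c (i + 1))
      (fun i => d (i + 1)) fun i hi => h (i + 1) (by simp only [Finset.mem_Icc] at hi ⊢; omega)
    have hrec := Z_wtC_add_two (k := k) (q := k + 1) (Or.inr rfl) (a := a) (b := b) (c := c)
      (d := d) fun i hi => h i (by simp only [Finset.mem_Icc] at hi ⊢; omega)
    rw [show k + (k + 1) = 2 * k + 1 by ring, ih'] at hrec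
    have hD : ∀ i, Delta (fun i => a (i + 1)) (fun i => b (i + 1)) (fun i => c (i + 1))
      (fun i => d (i + 1)) i = Delta a b c d (i + 1) := fun _ => rfl
    simp only [hD] at hrec
    rw [show 2 * (k + 1) + 1 = 2 * k + 1 + 2 by ring, hrec, prod_zpow_neg_succ,
      show 2 * (k + 1) + 2 = 2 * k + 4 by ring]
    generalize Delta a b c d = D
    have T1 : (∏ i ∈ Finset.Icc 1 (k + 1 + 1), a i ^ (k + 1 + 1 - i) *
        b (2 * k + 4 - i) ^ (k + 1 + 1 - i) *
          c (2 * k + 4 - i) ^ (k + 1 + 1 - i) * d i ^ (k + 1 + 1 - i)) =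
        (∏ i ∈ Finset.Icc 1 (k + 1), a (i + 1) ^ (k + 1 - i) *
          b (2 * k + 2 - i + 1) ^ (k + 1 - i) *
            c (2 * k + 2 - i + 1) ^ (k + 1 - i) * d (i + 1) ^ (k + 1 - i)) *
        (a 1 ^ (k + 1) * b (2 * k + 1 + 2) ^ (k + 1) * c (2 * k + 1 + 2) ^ (k + 1) *
          d 1 ^ (k + 1)) := by
      rw [prod_Icc_one, prod_Icc_one, Finset.prod_range_succ']
      congr 1
      refine Finset.prod_congr rfl fun i hi => ?_
      have := Finset.mem_range.1 hi
      rw [show k + 1 + 1 - (i + 1 + 1) = k + 1 - (i + 1) by omega,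
        show 2 * k + 4 - (i + 1 + 1) = 2 * k + 2 - (i + 1) + 1 by omega]
    have T3 : (∏ i ∈ Finset.Icc 1 (k + 1), (D i + D (i + 1)) ^ i) =
        (∏ i ∈ Finset.Icc 1 k, (D (i + 1) + D (i + 1 + 1)) ^ i) *
          ∏ i ∈ Finset.range (k + 1), (D (i + 1) + D (i + 2)) := by
      rw [prod_Icc_one, prod_Icc_one]
      exact prod_range_pow_succ (fun i => D (i + 1) + D (i + 2)) (k + 1)
    have T4 : (∏ i ∈ Finset.Icc 1 (k + 1),
          (D (2 * k + 1 + 2 - i) + D (2 * k + 4 - i)) ^ i) =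
        (∏ i ∈ Finset.Icc 1 k, (D (2 * k + 1 - i + 1) + D (2 * k + 2 - i + 1)) ^ i) *
          ∏ i ∈ Finset.range (k + 1), (D (2 * k + 1 - i + 1) + D (2 * k + 1 - i + 2)) := by
      rw [prod_Icc_one, prod_Icc_one]
      refine Eq.trans (Finset.prod_congr rfl fun i hi => ?_) ((prod_range_pow_succ
        (fun i => D (2 * k + 1 - i + 1) + D (2 * k + 1 - i + 2)) (k + 1)).trans ?_)
      · have := Finset.mem_range.1 hi
        rw [show 2 * k + 1 + 2 - (i + 1) = 2 * k + 1 - i + 1 by omega,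
          show 2 * k + 4 - (i + 1) = 2 * k + 1 - i + 2 by omega]
      · rw [Nat.add_sub_cancel]
        congr 1
        refine Finset.prod_congr rfl fun i hi => ?_
        have := Finset.mem_range.1 hi
        rw [show 2 * k + 1 - (i + 1) + 2 = 2 * k + 2 - (i + 1) + 1 by omega]
    have TS : (∏ j ∈ Finset.range (2 * k + 1 + 1), (D (j + 1) + D (j + 2))) =
        (∏ i ∈ Finset.range (k + 1), (D (i + 1) + D (i + 2))) *
          ∏ i ∈ Finset.range (k + 1), (D (2 * k + 1 - i + 1) + D (2 * k + 1 - i + 2)) := by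
      rw [show 2 * k + 1 + 1 = k + 1 + (k + 1) by ring,
        prod_range_split_reflect (fun j => D (j + 1) + D (j + 2)),
        show k + 1 + (k + 1) - 1 = 2 * k + 1 by omega]
    rw [T1, T3, T4, TS]
    ring

end Aztec

theorem theorem5p6 :
    (∀ (k : ℕ) (hk : 0 < k) (a b c d : ℕ → ℝ),
      (∀ i ∈ Finset.Icc 1 (2 * k), 0 < a i ∧ 0 < b i ∧ 0 < c i ∧ 0 < d i) →
      Aztec.M (p := 4) (q := 2 * (2 * k)) (by omega) (by omega) (2 * k)
          (Aztec.patternC (2 * k) a b c d) =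
        (∏ i ∈ Finset.Icc 1 k,
          a i ^ (k + 1 - i) * b (2 * k + 1 - i) ^ (k + 1 - i) *
            c (2 * k + 1 - i) ^ (k - i) * d i ^ (k - i)) *
        (∏ i ∈ Finset.Icc 1 (2 * k), Aztec.Delta a b c d i ^ (-(k : ℤ))) *
        (∏ i ∈ Finset.Icc 1 (k - 1),
          (Aztec.Delta a b c d i + Aztec.Delta a b c d (i + 1)) ^ i) *
        (∏ i ∈ Finset.Icc 1 k,
          (Aztec.Delta a b c d (2 * k - i) + Aztec.Delta a b c d (2 * k + 1 - i)) ^ i)) ∧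
    (∀ (k : ℕ) (a b c d : ℕ → ℝ),
      (∀ i ∈ Finset.Icc 1 (2 * k + 1), 0 < a i ∧ 0 < b i ∧ 0 < c i ∧ 0 < d i) →
      Aztec.M (p := 4) (q := 2 * (2 * k + 1)) (by omega) (by omega) (2 * k + 1)
          (Aztec.patternC (2 * k + 1) a b c d) =
        (∏ i ∈ Finset.Icc 1 (k + 1),
          a i ^ (k + 1 - i) * b (2 * k + 2 - i) ^ (k + 1 - i) *
            c (2 * k + 2 - i) ^ (k + 1 - i) * d i ^ (k + 1 - i)) *
        Aztec.Delta a b c d (k + 1) *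
        (∏ i ∈ Finset.Icc 1 (2 * k + 1), Aztec.Delta a b c d i ^ (-(k : ℤ))) *
        (∏ i ∈ Finset.Icc 1 k,
          (Aztec.Delta a b c d i + Aztec.Delta a b c d (i + 1)) ^ i) *
        (∏ i ∈ Finset.Icc 1 k,
          (Aztec.Delta a b c d (2 * k + 1 - i) + Aztec.Delta a b c d (2 * k + 2 - i)) ^ i)) := by
  refine ⟨fun k hk a b c d h => ?_, fun k a b c d h => ?_⟩
  · rw [Aztec.M_patternC]
    exact Aztec.Z_wtC_even k a b c d h
  · rw [Aztec.M_patternC]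
    exact Aztec.Z_wtC_odd k a b c d h
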